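/- Let $\mathbb{R}_+=[0,\infty)$ and $(k*v)(t)=\int_0^t k(t-\tau)v(\tau)\,d\tau$. Let $(k,l)\in\mathcal{PC}$, that is, $k,l\in L_{1,loc}(\mathbb{R}_+)$, $k$ is nonnegative and nonincreasing on $(0,\infty)$, and $k*l=1$ on $(0,\infty)$ (almost everywhere). Let $\alpha_0<\alpha$ be real numbers, let $f:(\alpha_0,\infty)\to\mathbb{R}$ be locally Lipschitz continuous, let $f|_{[\alpha,\infty)}$ be positive and nondecreasing, and assume $$\int_\alpha^\infty \frac{dr}{f(r)}<\infty .$$ For $u_0\in(\alpha_0,\infty)$ consider the problem $$\frac{d}{dt}\big(k*[u-u_0]\big)(t)=f(u(t)),\quad t>0,\qquad u(0)=u_0. \qquad (*)$$ For $a>0$, a solution of $(*)$ on $(0,a)$ is a function $u\in L_\infty((0,a))$ whose essential range is contained in a compact subset of $(\alpha_0,\infty)$, such that $k*[u-u_0]$ is absolutely continuous on $[0,a]$ and the equation in $(*)$ holds almost everywhere on $(0,a)$. We say that the solution of $(*)$ blows up in finite time if there are $t_*\in(0,\infty)$ and a continuous function $u:[0,t_*)\to\mathbb{R}$ with $u(0)=u_0$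 such that $u$ is a solution on $(0,a)$ for every $a\in(0,t_*)$; every solution $v$ of $(*)$ on an interval $(0,a)$ satisfies $a\le t_*$ and $v=u$ almost everywhere on $(0,a)$ (so $u$ is the unique solution, and $[0,t_*)$ is its maximal interval of existence); and $\|u\|_{L_\infty((0,a))}\to\infty$ as $a\to t_*-$. Then the following statements hold. (i) If $l\notin L_1(\mathbb{R}_+)$, then for every $u_0\in[\alpha,\infty)$ the solution of $(*)$ blows up in finite time. (ii) If $l\in L_1(\mathbb{R}_+)$, then there exists $\beta\ge\alpha$ such that for every $u_0\in[\beta,\infty)$ the solution of $(*)$ blows up in finite time. -/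

import Mathlib

open MeasureTheory Set Filter Topology

noncomputable section

namespace Subdiffusion

/-- Convolution on the positive half-line, `(k ∗ v)(t) = ∫₀ᵗ k(t - τ) v(τ) dτ`. -/
def conv (k v : ℝ → ℝ) (t : ℝ) : ℝ :=
  ∫ τ in (0 : ℝ)..t, k (t - τ) * v τ

/-- `(k, l) ∈ PC`: the kernels `k, l` lie in `L¹_loc([0,∞))`, `k` is nonnegative and nonincreasing
on `(0,∞)`, and `k ∗ l = 1` on `(0,∞)` (an identity in `L¹_loc`, that is, almost everywhere). -/
structure IsPC (k l : ℝ → ℝ) : Prop where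
  locallyIntegrable_left : LocallyIntegrableOn k (Ici 0)
  locallyIntegrable_right : LocallyIntegrableOn l (Ici 0)
  nonneg : ∀ t ∈ Ioi (0 : ℝ), 0 ≤ k t
  antitone : AntitoneOn k (Ioi 0)
  conv_eq_one : ∀ᵐ t ∂(volume.restrict (Ioi (0 : ℝ))), conv k l t = 1

/-- `u ∈ L^∞((0,a))` solves `d/dt (k ∗ [u - u₀]) = f(u)` on `(0,a)`, where `f` is a function on
`(α₀,∞)`. The essential range of `u` is contained in a compact subset of the domain `(α₀,∞)`
of `f`; the function `k ∗ [u - u₀]` is absolutely continuous on `[0,a]` (it vanishes at `0` by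
definition of the convolution), and the equation holds almost everywhere. -/
structure IsSolutionOn (k f : ℝ → ℝ) (α₀ u₀ a : ℝ) (u : ℝ → ℝ) : Prop where
  memLp : MemLp u ⊤ (volume.restrict (Ioo 0 a))
  lower : ∃ m > α₀, ∀ᵐ t ∂(volume.restrict (Ioo 0 a)), m ≤ u t
  absCont : AbsolutelyContinuousOnInterval (conv k (fun τ => u τ - u₀)) 0 a
  equation : ∀ᵐ t ∂(volume.restrict (Ioo 0 a)),
    HasDerivAt (conv k (fun τ => u τ - u₀)) (f (u t)) t

/-- `u` is the solution of `d/dt (k ∗ [u - u₀]) = f(u)`, `u(0) = u₀`, with maximal interval of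
existence `[0,T)`, `T ∈ (0,∞]`: it solves the problem on `(0,a)` for each `a < T`, is
(normalized to be) continuous with initial value `u₀`, and every solution on an interval `(0,a)`
is a restriction of it. -/
structure IsMaximalSolution (k f : ℝ → ℝ) (α₀ u₀ : ℝ) (T : EReal) (u : ℝ → ℝ) : Prop where
  pos : 0 < T
  initial : u 0 = u₀
  continuousOn : ContinuousOn u {t : ℝ | 0 ≤ t ∧ (t : EReal) < T}
  isSolutionOn : ∀ a : ℝ, 0 < a → (a : EReal) < T → IsSolutionOn k f α₀ u₀ a u
  greatest : ∀ (a : ℝ) (v : ℝ → ℝ), 0 < a → IsSolutionOn k f α₀ u₀ a v →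
    (a : EReal) ≤ T ∧ v =ᵐ[volume.restrict (Ioo 0 a)] u

/-- The (unique, maximal) solution with initial value `u₀` exists and blows up in finite time: its
maximal existence time `T` is finite, and `‖u‖_{L^∞((0,a))} → ∞` as `a → T-`. -/
def SolutionBlowsUp (k f : ℝ → ℝ) (α₀ u₀ : ℝ) : Prop :=
  ∃ (T : ℝ) (u : ℝ → ℝ), IsMaximalSolution k f α₀ u₀ (T : EReal) u ∧
    Tendsto (fun a : ℝ => eLpNorm u ⊤ (volume.restrict (Ioo 0 a))) (𝓝[<] T) (𝓝 ⊤)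

end Subdiffusion

end

namespace Subdiffusion

open scoped Convolution

/-! Since `k ∗ l = 1`, convolving with `l` and with `k` shows that the problem is equivalent to the
Volterra equation `u = u₀ + l ∗ f(u)`. Put `L(t) = ∫₀ᵗ l`. The core is a criterion: the solution
blows up as soon as `L(τ₀) > ∫_{u₀}^∞ dr/f(r)` for some `τ₀` (`IsPC.solutionBlowsUp`). Both cases
follow. If `l ≥ 0` is not integrable, `L` is unbounded; otherwise `L(1) > 0` still exceeds the tail
integral once `u₀` is large.

For the criterion, the solution is nondecreasing, and for nondecreasing `F ≥ 0` one has `∫₀ᵗ l F ≤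
(l ∗ F)(t)` (`IsPC.integral_mul_le_conv`). Hence `y = u₀ + ∫₀ᵗ l f(u)` satisfies `y ≤ u` and `y' = l
f(u) ≥ l f(y)`. Separating variables gives `L(t) ≤ ∫_{u₀}^{u(t)} dr/f`, so every level is passed
before `τ₀`.

The layer-cake formula reduces the rearrangement inequality to `L(t) - L(ρ) ≤ L(t - ρ)`, the
subadditivity of `L`. Neither this nor `l ≥ 0` is assumed; both come from the monotonicity of `k`. A
minimum principle for `v ↦ k ∗ v` gives `l ≥ 0`. For `z = L(t + ·) - L(t) - L`, the function `k ∗ z`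
starts at `0` and is nonincreasing, and convolving it with `l ≥ 0` gives `z ≤ 0`.

The maximal solution is glued from solutions for `f` frozen above a level `M`; a weighted sup norm
gives uniqueness. -/

/-! ### Convolution on bounded intervals: continuity, bounds, associativity -/

lemma conv_comm (a b : ℝ → ℝ) (t : ℝ) : conv a b t = conv b a t := by
  unfold conv
  have h := intervalIntegral.integral_comp_sub_left (a := 0) (b := t)
    (fun s => b (t - s) * a s) t
  simp only [sub_sub_cancel, sub_zero, sub_self] at h
  rw [← h]
  exact intervalIntegral.integral_congr fun s _ => mul_comm _ _

lemma conv_apply_zero (a b : ℝ → ℝ) : conv a b 0 = 0 := by simp [conv]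

/-- The convolution on `[0,A]` is the convolution on `ℝ` of the truncated functions. -/
lemma conv_eq_convolution (a b : ℝ → ℝ) {A t : ℝ} (ht : 0 ≤ t) (htA : t ≤ A) :
    conv a b t = ((Ioc 0 A).indicator a ⋆[ContinuousLinearMap.mul ℝ ℝ] (Ioc 0 A).indicator b) t := by
  rw [conv_comm, conv, intervalIntegral.integral_of_le ht, integral_Ioc_eq_integral_Ioo,
    ← integral_indicator measurableSet_Ioo, convolution_def]
  congr 1
  ext s
  by_cases hs : s ∈ Ioo 0 t
  · have h1 : s ∈ Ioc 0 A := ⟨hs.1, by linarith [hs.2]⟩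
    have h2 : t - s ∈ Ioc 0 A := ⟨by linarith [hs.2], by linarith [hs.1]⟩
    simp [hs, h1, h2, mul_comm]
  · by_cases h1 : s ∈ Ioc 0 A
    · have h2 : t - s ∉ Ioc 0 A := fun h => hs ⟨h1.1, by linarith [h.1]⟩
      simp [hs, h2]
    · simp [hs, h1]

lemma convolution_indicator_eq_zero (a b : ℝ → ℝ) {A t : ℝ} (ht : t ≤ 0) :
    ((Ioc 0 A).indicator a ⋆[ContinuousLinearMap.mul ℝ ℝ] (Ioc 0 A).indicator b) t = 0 := by
  rw [convolution_def]
  refine integral_eq_zero_of_ae (Eventually.of_forall fun s => ?_)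
  by_cases h1 : s ∈ Ioc 0 A
  · have h2 : t - s ∉ Ioc 0 A := fun h => by linarith [h.1, h1.1]
    simp [h2]
  · simp [h1]

/-- Only the values on `(0,t)` matter for the convolution at `t`. -/
lemma convolution_congr_Ioo {a a' b b' : ℝ → ℝ} {t : ℝ}
    (ha : ∀ s ∈ Ioo 0 t, a s = a' s) (hb : ∀ s ∈ Ioo 0 t, b s = b' s)
    (ha0 : ∀ s ≤ 0, a s = 0) (hb0 : ∀ s ≤ 0, b s = 0)
    (ha0' : ∀ s ≤ 0, a' s = 0) (hb0' : ∀ s ≤ 0, b' s = 0) :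
    (a ⋆[ContinuousLinearMap.mul ℝ ℝ] b) t = (a' ⋆[ContinuousLinearMap.mul ℝ ℝ] b') t := by
  rw [convolution_def, convolution_def]
  congr 1
  ext s
  rcases le_or_gt s 0 with h | h
  · simp [ha0 s h, ha0' s h]
  · rcases le_or_gt t s with h' | h'
    · simp [hb0 (t - s) (by linarith), hb0' (t - s) (by linarith)]
    · rw [ha s ⟨h, h'⟩, hb (t - s) ⟨by linarith, by linarith⟩]

lemma bound_indicator {c : ℝ → ℝ} {A C : ℝ} (hC : ∀ x ∈ Ioc 0 A, |c x| ≤ C) (hC0 : 0 ≤ C) (x : ℝ) :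
    ‖(Ioc 0 A).indicator c x‖ ≤ C := by
  by_cases h : x ∈ Ioc 0 A
  · simpa [h] using hC x h
  · simpa [h] using hC0

lemma convolutionExistsAt_of_bound {b c : ℝ → ℝ} {C : ℝ} (hb : Integrable b)
    (hc : AEStronglyMeasurable c) (hC : ∀ x, ‖c x‖ ≤ C) (t : ℝ) :
    ConvolutionExistsAt b c t (ContinuousLinearMap.mul ℝ ℝ) := by
  have h : AEStronglyMeasurable (fun s => c (t - s)) :=
    hc.comp_quasiMeasurePreserving (quasiMeasurePreserving_sub_left_of_right_invariant volume t)
  exact Integrable.mul_bdd (c := C) hb h (Eventually.of_forall fun s => hC _)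

/-- Approximating `b` in `L¹` by continuous compactly supported functions makes the convolutions
converge uniformly, because `c` is bounded. -/
lemma continuous_convolution_of_bound {b c : ℝ → ℝ} {C : ℝ} (hb : Integrable b)
    (hc : AEStronglyMeasurable c) (hci : LocallyIntegrable c) (hC : ∀ x, ‖c x‖ ≤ C) :
    Continuous (b ⋆[ContinuousLinearMap.mul ℝ ℝ] c) := by
  have hC0 : 0 ≤ C := (norm_nonneg _).trans (hC 0)
  refine continuous_of_uniform_approx_of_continuous fun u hu => ?_
  obtain ⟨ε, hε, hεu⟩ := Metric.mem_uniformity_dist.1 hu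
  obtain ⟨g, hgs, hg, hgc, hgi⟩ :=
    -- `C + 1` instead of `C` avoids division by zero, and the factor `2` makes the final inequality
    -- strict.
    hb.exists_hasCompactSupport_integral_sub_le (ε := ε / (2 * (C + 1))) (by positivity)
  refine ⟨_, hgs.continuous_convolution_left (ContinuousLinearMap.mul ℝ ℝ) hgc hci, fun t => ?_⟩
  apply hεu
  have h1 := convolutionExistsAt_of_bound hb hc hC t
  have h2 := convolutionExistsAt_of_bound hgi hc hC t
  rw [dist_eq_norm, convolution_def, convolution_def, ← integral_sub h1 h2]
  have hle : ‖∫ s, (ContinuousLinearMap.mul ℝ ℝ (b s) (c (t - s))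
      - ContinuousLinearMap.mul ℝ ℝ (g s) (c (t - s)))‖ ≤ ∫ s, ‖b s - g s‖ * C := by
    refine norm_integral_le_of_norm_le ((hb.sub hgi).norm.mul_const C)
      (Eventually.of_forall fun s => ?_)
    simp only [ContinuousLinearMap.mul_apply']
    rw [← sub_mul, norm_mul]
    exact mul_le_mul_of_nonneg_left (hC _) (norm_nonneg _)
  rw [integral_mul_const] at hle
  calc _ ≤ (∫ s, ‖b s - g s‖) * C := hle
    _ ≤ ε / (2 * (C + 1)) * (C + 1) := by gcongr; linarith
    _ < ε := by
      rw [div_mul_eq_mul_div, div_lt_iff₀ (by positivity)]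
      nlinarith

section

variable {a b c : ℝ → ℝ} {A C : ℝ}

lemma continuousOn_conv (hb : IntegrableOn b (Ioc 0 A))
    (hc : AEStronglyMeasurable c (volume.restrict (Ioc 0 A))) (hC : ∀ x ∈ Ioc 0 A, |c x| ≤ C) :
    ContinuousOn (conv b c) (Icc 0 A) := by
  rcases lt_or_ge A 0 with hA | hA
  · simp [Icc_eq_empty (not_le.2 hA)]
  have hC' : ∀ x ∈ Ioc 0 A, |c x| ≤ |C| := fun x hx => (hC x hx).trans (le_abs_self _)
  have hm : AEStronglyMeasurable ((Ioc 0 A).indicator c) :=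
    (aestronglyMeasurable_indicator_iff measurableSet_Ioc).2 hc
  have hbd := bound_indicator hC' (abs_nonneg C)
  have hli : LocallyIntegrable ((Ioc 0 A).indicator c) := by
    have : LocallyIntegrable (fun _ : ℝ => |C|) := locallyIntegrable_const _
    exact this.mono hm (Eventually.of_forall fun x => by simpa using hbd x)
  have := continuous_convolution_of_bound (b := (Ioc 0 A).indicator b)
    ((integrable_indicator_iff measurableSet_Ioc).2 hb) hm hli hbd
  exact this.continuousOn.congr fun t ht =>
    conv_eq_convolution _ _ ht.1 ht.2

lemma abs_conv_le (hb : IntegrableOn b (Ioc 0 A)) (hC : ∀ x ∈ Ioc 0 A, |c x| ≤ C) {t : ℝ}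
    (ht : t ∈ Icc 0 A) : |conv b c t| ≤ (∫ s in (0 : ℝ)..t, |b s|) * C := by
  have hsub : Ioc 0 t ⊆ Ioc 0 A := Ioc_subset_Ioc_right ht.2
  rw [conv_comm, conv, ← intervalIntegral.integral_mul_const, intervalIntegral.integral_of_le ht.1,
    intervalIntegral.integral_of_le ht.1, ← restrict_Ioo_eq_restrict_Ioc, ← Real.norm_eq_abs]
  refine norm_integral_le_of_norm_le
    (((hb.mono_set hsub).mono_set Ioo_subset_Ioc_self).norm.mul_const C) ?_
  refine (ae_restrict_mem measurableSet_Ioo).mono fun s hs => ?_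
  rw [Real.norm_eq_abs, abs_mul, mul_comm]
  exact mul_le_mul_of_nonneg_left (hC _ ⟨by linarith [hs.2], by linarith [hs.1, ht.2]⟩)
    (abs_nonneg _)

lemma integrableOn_conv_integrand (hb : IntegrableOn b (Ioc 0 A))
    (hc : AEStronglyMeasurable c (volume.restrict (Ioc 0 A))) (hC : ∀ x ∈ Ioc 0 A, |c x| ≤ C)
    {t : ℝ} (ht : t ∈ Icc 0 A) : IntegrableOn (fun s => b s * c (t - s)) (Ioc 0 t) := by
  have hC' : ∀ x ∈ Ioc 0 A, |c x| ≤ |C| := fun x hx => (hC x hx).trans (le_abs_self _)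
  have h := convolutionExistsAt_of_bound ((integrable_indicator_iff measurableSet_Ioc).2 hb)
    ((aestronglyMeasurable_indicator_iff measurableSet_Ioc).2 hc)
    (bound_indicator hC' (abs_nonneg C)) t
  rw [integrableOn_Ioc_iff_integrableOn_Ioo]
  refine (Integrable.integrableOn h (s := Ioo 0 t)).congr_fun (fun s hs => ?_) measurableSet_Ioo
  have h1 : s ∈ Ioc 0 A := ⟨hs.1, by linarith [hs.2, ht.2]⟩
  have h2 : t - s ∈ Ioc 0 A := ⟨by linarith [hs.2], by linarith [hs.1, ht.2]⟩
  simp [h1, h2]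

/-- Associativity of the convolution of two integrable functions and a bounded one. -/
lemma conv_assoc (ha : IntegrableOn a (Ioc 0 A)) (hb : IntegrableOn b (Ioc 0 A))
    (hc : AEStronglyMeasurable c (volume.restrict (Ioc 0 A))) (hC : ∀ x ∈ Ioc 0 A, |c x| ≤ C)
    {t : ℝ} (ht : t ∈ Icc 0 A) : conv (conv a b) c t = conv a (conv b c) t := by
  have hC' : ∀ x ∈ Ioc 0 A, |c x| ≤ |C| := fun x hx => (hC x hx).trans (le_abs_self _)
  set a' := (Ioc 0 A).indicator a with ha'
  set b' := (Ioc 0 A).indicator b with hb'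
  set c' := (Ioc 0 A).indicator c with hc'
  have hai : Integrable a' := (integrable_indicator_iff measurableSet_Ioc).2 ha
  have hbi : Integrable b' := (integrable_indicator_iff measurableSet_Ioc).2 hb
  have hcm : AEStronglyMeasurable c' := (aestronglyMeasurable_indicator_iff measurableSet_Ioc).2 hc
  have hcb : ∀ x, ‖c' x‖ ≤ |C| := bound_indicator hC' (abs_nonneg C)
  have hci : Integrable c' := by
    refine (integrable_indicator_iff measurableSet_Ioc).2 ?_
    exact Integrable.of_bound hc |C|
      ((ae_restrict_mem measurableSet_Ioc).mono fun x hx => hC' x hx)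
  have key : ((a' ⋆[ContinuousLinearMap.mul ℝ ℝ] b') ⋆[ContinuousLinearMap.mul ℝ ℝ] c') t
      = (a' ⋆[ContinuousLinearMap.mul ℝ ℝ] (b' ⋆[ContinuousLinearMap.mul ℝ ℝ] c')) t := by
    refine convolution_assoc _ _ _ _ (fun x y z => by simp [mul_assoc]) hai.1 hbi.1 hcm
      (hai.ae_convolution_exists _ hbi)
      (Eventually.of_forall fun x => convolutionExistsAt_of_bound hbi.norm hcm.norm
        (C := |C|) (fun x => by simpa using hcb x) x) ?_
    refine convolutionExistsAt_of_bound (C := (∫ s, ‖b' s‖) * |C|) hai.norm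
      (hbi.norm.integrable_convolution (ContinuousLinearMap.mul ℝ ℝ) hci.norm).1 (fun x => ?_) t
    rw [convolution_def, ← integral_mul_const]
    refine norm_integral_le_of_norm_le (hbi.norm.mul_const _) (Eventually.of_forall fun s => ?_)
    simp only [ContinuousLinearMap.mul_apply', norm_mul, norm_norm]
    exact mul_le_mul_of_nonneg_left (hcb _) (norm_nonneg _)
  have hz : ∀ (g : ℝ → ℝ), ∀ s ≤ 0, (Ioc 0 A).indicator g s = 0 := fun g s hs =>
    indicator_of_notMem (fun h => by linarith [h.1]) _
  rw [conv_eq_convolution _ _ ht.1 ht.2, conv_eq_convolution _ _ ht.1 ht.2]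
  have hmem : ∀ s ∈ Ioo 0 t, s ∈ Ioc 0 A := fun s hs => ⟨hs.1, by linarith [hs.2, ht.2]⟩
  -- The truncation of `conv a b` to `(0,A]` differs from `a' ⋆ b'` beyond `A`, but the outer
  -- convolution at `t ≤ A` only sees arguments in `(0,t)`.
  calc _ = ((a' ⋆[ContinuousLinearMap.mul ℝ ℝ] b') ⋆[ContinuousLinearMap.mul ℝ ℝ] c') t := by
        refine convolution_congr_Ioo (fun s hs => ?_) (fun s _ => rfl) (hz _) (hz _)
          (fun s hs => convolution_indicator_eq_zero _ _ hs) (hz _)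
        rw [indicator_of_mem (hmem s hs), conv_eq_convolution _ _ hs.1.le (hmem s hs).2]
    _ = _ := key
    _ = _ := by
        refine (convolution_congr_Ioo (fun s _ => rfl) (fun s hs => ?_) (hz _) (hz _) (hz _)
          (fun s hs => convolution_indicator_eq_zero _ _ hs)).symm
        rw [indicator_of_mem (hmem s hs), conv_eq_convolution _ _ hs.1.le (hmem s hs).2]

lemma conv_congr_ae_left {a' : ℝ → ℝ} (h : a =ᵐ[volume.restrict (Ioc 0 A)] a') {t : ℝ}
    (ht : t ∈ Icc 0 A) : conv a b t = conv a' b t := by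
  rw [conv_comm, conv_comm a', conv, conv]
  refine intervalIntegral.integral_congr_ae ?_
  rw [uIoc_of_le ht.1]
  filter_upwards [(ae_restrict_iff' measurableSet_Ioc).1 h] with s hs hs'
  rw [hs ⟨hs'.1, hs'.2.trans ht.2⟩]

lemma conv_congr_ae_right {b' : ℝ → ℝ} (h : b =ᵐ[volume.restrict (Ioc 0 A)] b') {t : ℝ}
    (ht : t ∈ Icc 0 A) : conv a b t = conv a b' t := by
  rw [conv_comm, conv_congr_ae_left h ht, conv_comm]

lemma conv_one_left (b : ℝ → ℝ) (t : ℝ) : conv (fun _ => 1) b t = ∫ s in (0 : ℝ)..t, b s := by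
  simp [conv]

lemma conv_one_right (b : ℝ → ℝ) (t : ℝ) : conv b (fun _ => 1) t = ∫ s in (0 : ℝ)..t, b s := by
  rw [conv_comm, conv_one_left]

end

/-! ### Inversion formulas from `k ∗ l = 1` -/

namespace IsPC

variable {k l : ℝ → ℝ} {A : ℝ}

lemma integrableOn_left (h : IsPC k l) (A : ℝ) : IntegrableOn k (Ioc 0 A) :=
  (h.locallyIntegrable_left.integrableOn_compact_subset (t := Icc 0 A)
    Icc_subset_Ici_self isCompact_Icc).mono_set Ioc_subset_Icc_self

lemma integrableOn_right (h : IsPC k l) (A : ℝ) : IntegrableOn l (Ioc 0 A) :=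
  (h.locallyIntegrable_right.integrableOn_compact_subset (t := Icc 0 A)
    Icc_subset_Ici_self isCompact_Icc).mono_set Ioc_subset_Icc_self

lemma conv_ae_eq_one (h : IsPC k l) (A : ℝ) : conv k l =ᵐ[volume.restrict (Ioc 0 A)] fun _ => 1 :=
  ae_restrict_of_ae_restrict_of_subset Ioc_subset_Ioi_self h.conv_eq_one

/-- By associativity `k ∗ (l ∗ c) = (k ∗ l) ∗ c = 1 ∗ c`. With its mirror image below it translates
between the differential and the Volterra form. -/
lemma conv_left_conv_right (h : IsPC k l) {c : ℝ → ℝ} {C t : ℝ}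
    (hc : AEStronglyMeasurable c (volume.restrict (Ioc 0 A))) (hC : ∀ x ∈ Ioc 0 A, |c x| ≤ C)
    (ht : t ∈ Icc 0 A) : conv k (conv l c) t = ∫ s in (0 : ℝ)..t, c s := by
  rw [← conv_assoc (h.integrableOn_left A) (h.integrableOn_right A) hc hC ht,
    conv_congr_ae_left (h.conv_ae_eq_one A) ht, conv_one_left]

lemma conv_right_conv_left (h : IsPC k l) {c : ℝ → ℝ} {C t : ℝ}
    (hc : AEStronglyMeasurable c (volume.restrict (Ioc 0 A))) (hC : ∀ x ∈ Ioc 0 A, |c x| ≤ C)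
    (ht : t ∈ Icc 0 A) : conv l (conv k c) t = ∫ s in (0 : ℝ)..t, c s := by
  have h1 : conv l k = conv k l := funext fun t => conv_comm l k t
  rw [← conv_assoc (h.integrableOn_right A) (h.integrableOn_left A) hc hC ht, h1,
    conv_congr_ae_left (h.conv_ae_eq_one A) ht, conv_one_left]

end IsPC

/-! ### A minimum principle for nonincreasing kernels -/

lemma IntegrableOn.intervalIntegrable_of_mem {k : ℝ → ℝ} {A s t : ℝ}
    (hk : IntegrableOn k (Ioc 0 A)) (hs : s ∈ Icc 0 A) (ht : t ∈ Icc 0 A) :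
    IntervalIntegrable k volume s t := by
  rw [intervalIntegrable_iff]
  exact hk.mono_set fun x hx => ⟨lt_of_le_of_lt (le_min hs.1 ht.1) hx.1,
    hx.2.trans (max_le hs.2 ht.2)⟩

lemma continuousOn_primitive_of_integrableOn {k : ℝ → ℝ} {A : ℝ} (hk : IntegrableOn k (Ioc 0 A)) :
    ContinuousOn (fun t => ∫ s in (0 : ℝ)..t, k s) (Icc 0 A) :=
  intervalIntegral.continuousOn_primitive ((integrableOn_Icc_iff_integrableOn_Ioc).2 hk) |>.congr
    fun t ht => by rw [intervalIntegral.integral_of_le ht.1]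

/-- Shifting the part over `(h,t)` by `h` aligns it with `(k ∗ v)(t - h)`, so that increments of `k
∗ v` involve `k(s + h) - k(s)`, whose sign is known. -/
lemma conv_eq_split (k v : ℝ → ℝ) {t h : ℝ}
    (h1 : IntervalIntegrable (fun s => k s * v (t - s)) volume 0 h)
    (h2 : IntervalIntegrable (fun s => k s * v (t - s)) volume h t) :
    conv k v t = (∫ s in (0 : ℝ)..h, k s * v (t - s))
      + ∫ s in (0 : ℝ)..(t - h), k (s + h) * v (t - h - s) := by
  have h3 := intervalIntegral.integral_comp_add_right (a := 0) (b := t - h)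
    (fun s => k s * v (t - s)) h
  simp only [zero_add, sub_add_cancel] at h3
  have h4 : (∫ s in (0 : ℝ)..(t - h), k (s + h) * v (t - h - s))
      = ∫ s in (0 : ℝ)..(t - h), k (s + h) * v (t - (s + h)) :=
    intervalIntegral.integral_congr fun s _ => by
      rw [show t - h - s = t - (s + h) by ring]
  rw [h4, h3, intervalIntegral.integral_add_adjacent_intervals h1 h2, conv_comm, conv]
  exact intervalIntegral.integral_congr fun s _ => mul_comm _ _

/-- Increments of `k ∗ v` at a nonpositive minimum of `v`, for nonincreasing `k ≥ 0`. -/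
lemma conv_sub_conv_le {k v : ℝ → ℝ} {t h m C : ℝ} (hk : IntegrableOn k (Ioc 0 t))
    (hk0 : ∀ s ∈ Ioi (0 : ℝ), 0 ≤ k s) (hkm : AntitoneOn k (Ioi 0))
    (hv : ContinuousOn v (Icc 0 t)) (hm : m ≤ 0) (hvm : ∀ s ∈ Icc 0 t, m ≤ v s)
    (h0 : 0 < h) (ht : h < t) (hC : ∀ s ∈ Icc 0 h, v (t - s) ≤ m + C) :
    conv k v t - conv k v (t - h) ≤ C * ∫ s in (0 : ℝ)..h, k s := by
  have m0 : (0 : ℝ) ∈ Icc 0 t := ⟨le_rfl, by linarith⟩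
  have mh : h ∈ Icc 0 t := ⟨h0.le, ht.le⟩
  have mt : t ∈ Icc 0 t := ⟨by linarith, le_rfl⟩
  have mth : t - h ∈ Icc 0 t := ⟨by linarith, by linarith⟩
  have hvt : ContinuousOn (fun s => v (t - s)) (Icc 0 t) :=
    hv.comp (by fun_prop) fun s hs => ⟨by linarith [hs.2], by linarith [hs.1]⟩
  have ii : ∀ x ∈ Icc 0 t, ∀ y ∈ Icc 0 t, IntervalIntegrable k volume x y := fun x hx y hy =>
    IntegrableOn.intervalIntegrable_of_mem hk hx hy
  have iiv : ∀ x ∈ Icc 0 t, ∀ y ∈ Icc 0 t,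
      IntervalIntegrable (fun s => k s * v (t - s)) volume x y := fun x hx y hy =>
    (ii x hx y hy).mul_continuousOn (hvt.mono (uIcc_subset_Icc hx hy))
  have hvth : ContinuousOn (fun s => v (t - h - s)) (uIcc 0 (t - h)) := by
    rw [uIcc_of_le (by linarith)]
    exact hv.comp (by fun_prop) fun s hs => ⟨by linarith [hs.2], by linarith [hs.1]⟩
  have iksh : IntervalIntegrable (fun s => k (s + h)) volume 0 (t - h) := by
    simpa only [sub_self] using (ii h mh t mt).comp_add_right h
  have ik : IntervalIntegrable k volume 0 (t - h) := ii _ m0 _ mth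
  have e2 : conv k v (t - h) = ∫ s in (0 : ℝ)..(t - h), k s * v (t - h - s) := by
    rw [conv_comm, conv]
    exact intervalIntegral.integral_congr fun s _ => mul_comm _ _
  -- The increment is `∫₀ʰ k(s) v(t-s) ds + ∫₀^{t-h} (k(s+h) - k(s)) v(t-h-s) ds`. Using `v ≤ m + C`
  -- in the first term, and `v ≥ m` with `k(s+h) ≤ k(s)` in the second, bounds it by `C ∫₀ʰ k + m
  -- ∫_{t-h}^t k`; the last term is nonpositive.
  rw [conv_eq_split k v (iiv _ m0 _ mh) (iiv _ mh _ mt), e2, add_sub_assoc,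
    ← intervalIntegral.integral_sub (iksh.mul_continuousOn hvth) (ik.mul_continuousOn hvth)]
  have b1 : (∫ s in (0 : ℝ)..h, k s * v (t - s)) ≤ ∫ s in (0 : ℝ)..h, k s * (m + C) := by
    refine intervalIntegral.integral_mono_on_of_le_Ioo h0.le (iiv _ m0 _ mh)
      ((ii _ m0 _ mh).mul_const _) fun s hs => ?_
    exact mul_le_mul_of_nonneg_left (hC s ⟨hs.1.le, hs.2.le⟩) (hk0 s hs.1)
  have b2 : (∫ s in (0 : ℝ)..(t - h), (k (s + h) * v (t - h - s) - k s * v (t - h - s)))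
      ≤ ∫ s in (0 : ℝ)..(t - h), (k (s + h) - k s) * m := by
    refine intervalIntegral.integral_mono_on_of_le_Ioo (by linarith)
      ((iksh.mul_continuousOn hvth).sub (ik.mul_continuousOn hvth))
      ((iksh.sub ik).mul_const _) fun s hs => ?_
    rw [← sub_mul]
    refine mul_le_mul_of_nonpos_left (hvm _ ⟨by linarith [hs.2], by linarith [hs.1]⟩) ?_
    have hs0 : 0 < s := hs.1
    exact sub_nonpos.2 (hkm (mem_Ioi.2 hs0) (mem_Ioi.2 (by linarith)) (by linarith))
  have e3 : (∫ s in (0 : ℝ)..(t - h), k (s + h)) = ∫ s in h..t, k s := by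
    simp
  rw [intervalIntegral.integral_mul_const] at b1 b2
  rw [intervalIntegral.integral_sub iksh ik, e3] at b2
  have e4 := intervalIntegral.integral_add_adjacent_intervals (ii _ m0 _ mh) (ii _ mh _ mt)
  have e5 := intervalIntegral.integral_add_adjacent_intervals (ii _ m0 _ mth) (ii _ mth _ mt)
  have b3 : 0 ≤ ∫ s in (t - h)..t, k s :=
    intervalIntegral.integral_nonneg (by linarith) fun s hs =>
      hk0 s (by have := hs.1; simp only [mem_Ioi]; linarith)
  nlinarith

/-- A minimum principle: if `v` is Lipschitz, `v(0) = 0` and `k ∗ v` has a positive density, then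
`v ≥ 0`. -/
lemma nonneg_of_conv_eq_integral {k v g : ℝ → ℝ} {A C : ℝ} (hk : IntegrableOn k (Ioc 0 A))
    (hk0 : ∀ s ∈ Ioi (0 : ℝ), 0 ≤ k s) (hkm : AntitoneOn k (Ioi 0)) (hv0 : v 0 = 0)
    (hv : ∀ s ∈ Icc 0 A, ∀ t ∈ Icc 0 A, |v s - v t| ≤ C * |s - t|)
    (hg : ContinuousOn g (Icc 0 A)) (hg0 : ∀ s ∈ Ioc 0 A, 0 < g s)
    (hkv : ∀ t ∈ Icc 0 A, conv k v t = ∫ s in (0 : ℝ)..t, g s) {t : ℝ} (ht : t ∈ Icc 0 A) :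
    0 ≤ v t := by
  have hvc : ContinuousOn v (Icc 0 A) := by
    have : LipschitzOnWith (Real.toNNReal C) v (Icc 0 A) :=
      LipschitzOnWith.of_dist_le_mul fun s hs t ht => by
        rw [Real.dist_eq, Real.dist_eq]
        exact (hv s hs t ht).trans
          (mul_le_mul_of_nonneg_right (Real.le_coe_toNNReal C) (abs_nonneg _))
    exact this.continuousOn
  obtain ⟨t₁, ht₁, hmin⟩ := isCompact_Icc.exists_isMinOn ⟨t, ht⟩ hvc
  refine le_trans ?_ (hmin ht)
  by_contra! hneg
  have ht₁0 : 0 < t₁ := lt_of_le_of_ne ht₁.1 fun h => by rw [← h, hv0] at hneg; exact lt_irrefl _ hneg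
  obtain ⟨s₀, hs₀, hs₀min⟩ := isCompact_Icc.exists_isMinOn
    (nonempty_Icc.2 (show t₁ / 2 ≤ t₁ by linarith))
    (hg.mono (Icc_subset_Icc (show (0 : ℝ) ≤ t₁ / 2 by linarith) ht₁.2))
  have hc : 0 < g s₀ := hg0 _ ⟨by linarith [hs₀.1], hs₀.2.trans ht₁.2⟩
  have hC0 : 0 ≤ C := by
    have := (abs_nonneg _).trans (hv t₁ ht₁ 0 ⟨le_rfl, ht.1.trans ht.2⟩)
    rw [sub_zero, abs_of_pos ht₁0] at this
    exact nonneg_of_mul_nonneg_left this ht₁0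
  -- At a negative minimum `t₁`, the increment of `k ∗ v` over `[t₁-h, t₁]` is at least `h * g s₀`
  -- and at most `(C * h) ∫₀ʰ k`. Dividing by `h` and letting `h → 0` forces `g s₀ ≤ 0`.
  have key : ∀ h ∈ Ioo 0 (t₁ / 2), g s₀ ≤ C * ∫ s in (0 : ℝ)..h, k s := by
    intro h hh
    have hh1 := hh.1
    have hh2 := hh.2
    have hsub : Icc 0 t₁ ⊆ Icc 0 A := Icc_subset_Icc_right ht₁.2
    have m1 : t₁ - h ∈ Icc 0 A := hsub ⟨by linarith, by linarith⟩
    have hle := conv_sub_conv_le (C := C * h) (hk.mono_set (Ioc_subset_Ioc_right ht₁.2)) hk0 hkm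
      (hvc.mono hsub) hneg.le (fun s hs => hmin (hsub hs)) hh.1 (by linarith) (fun s hs => by
        have h1 := hv (t₁ - s) (hsub ⟨by linarith [hs.2], by linarith [hs.1]⟩) t₁ ht₁
        have h2 := le_of_abs_le h1
        rw [show t₁ - s - t₁ = -s by ring, abs_neg, abs_of_nonneg hs.1] at h2
        nlinarith [hs.2])
    rw [hkv _ ht₁, hkv _ m1] at hle
    have gi : ∀ x ∈ Icc 0 A, ∀ y ∈ Icc 0 A, IntervalIntegrable g volume x y := fun x hx y hy =>
      (hg.mono (uIcc_subset_Icc hx hy)).intervalIntegrable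
    rw [intervalIntegral.integral_interval_sub_left (gi _ ⟨le_rfl, ht.1.trans ht.2⟩ _ ht₁)
      (gi _ ⟨le_rfl, ht.1.trans ht.2⟩ _ m1)] at hle
    have hlow : ∫ _ in (t₁ - h)..t₁, g s₀ ≤ ∫ s in (t₁ - h)..t₁, g s :=
      intervalIntegral.integral_mono_on (by linarith) (by simp) (gi _ m1 _ ht₁)
        fun s hs => hs₀min ⟨by linarith [hs.1], hs.2⟩
    rw [intervalIntegral.integral_const, smul_eq_mul] at hlow
    have : h * g s₀ ≤ h * (C * ∫ s in (0 : ℝ)..h, k s) := by linarith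
    exact le_of_mul_le_mul_left this hh.1
  have hlim : Tendsto (fun h => C * ∫ s in (0 : ℝ)..h, k s) (𝓝[>] 0) (𝓝 0) := by
    have h1 := (continuousOn_primitive_of_integrableOn hk) 0 ⟨le_rfl, ht.1.trans ht.2⟩
    have h2 : Tendsto (fun h => ∫ s in (0 : ℝ)..h, k s) (𝓝[Icc 0 A] 0) (𝓝 0) := by
      simpa [ContinuousWithinAt] using h1
    have h3 : 𝓝[>] (0 : ℝ) ≤ 𝓝[Icc 0 A] 0 := by
      rw [← nhdsWithin_Ioc_eq_nhdsGT (ht₁0.trans_le ht₁.2)]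
      exact nhdsWithin_mono _ Ioc_subset_Icc_self
    simpa using (h2.mono_left h3).const_mul C
  have := ge_of_tendsto hlim (eventually_of_mem (Ioo_mem_nhdsGT (by linarith)) key)
  linarith

/-! ### Nonnegativity of `l` -/

lemma conv_eq_integral_of_zero {b g : ℝ → ℝ} {A t : ℝ} (hg0 : ∀ x ≤ 0, g x = 0)
    (ht : t ∈ Icc 0 A) : conv b g t = ∫ s in Ioc 0 A, b s * g (t - s) := by
  rw [conv_comm, conv, intervalIntegral.integral_of_le ht.1]
  simp only [mul_comm (g _)]
  refine (setIntegral_eq_of_subset_of_forall_sdiff_eq_zero measurableSet_Ioc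
    (Ioc_subset_Ioc_right ht.2) fun s hs => ?_).symm
  have : t < s := by
    by_contra! h
    exact hs.2 ⟨hs.1.1, h⟩
  rw [hg0 _ (by linarith), mul_zero]

/-- As `g` vanishes on `(-∞,0]`, both convolutions are integrals over the same interval `(0,A]`, and
the Lipschitz bound of `g` passes under the integral. -/
lemma abs_conv_sub_le {b g : ℝ → ℝ} {A N : ℝ} (hb : IntegrableOn b (Ioc 0 A))
    (hg0 : ∀ x ≤ 0, g x = 0) (hg : Continuous g) (hgN : ∀ x y, |g x - g y| ≤ N * |x - y|)
    {s t : ℝ} (hs : s ∈ Icc 0 A) (ht : t ∈ Icc 0 A) :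
    |conv b g s - conv b g t| ≤ ((∫ x in Ioc 0 A, |b x|) * N) * |s - t| := by
  have hi : ∀ t, IntegrableOn (fun x => b x * g (t - x)) (Ioc 0 A) := fun t =>
    ((integrableOn_Icc_iff_integrableOn_Ioc (f := b)).2 hb).mul_continuousOn
      (g' := fun x => g (t - x)) (by fun_prop) isCompact_Icc |>.mono_set Ioc_subset_Icc_self
  rw [conv_eq_integral_of_zero hg0 hs, conv_eq_integral_of_zero hg0 ht,
    ← integral_sub (hi s) (hi t), mul_assoc, ← integral_mul_const, ← Real.norm_eq_abs]
  refine norm_integral_le_of_norm_le (hb.norm.mul_const _) (Eventually.of_forall fun x => ?_)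
  rw [← mul_sub, norm_mul]
  refine mul_le_mul_of_nonneg_left ?_ (norm_nonneg _)
  simpa using hgN (s - x) (t - x)

/-- The continuous ramp which is `0` on `(-∞,0]` and `1` on `[1/N,∞)`. -/
noncomputable def ramp (N x : ℝ) : ℝ := min (max (N * x) 0) 1

lemma ramp_of_nonpos {N x : ℝ} (hN : 0 ≤ N) (hx : x ≤ 0) : ramp N x = 0 := by
  have : N * x ≤ 0 := mul_nonpos_of_nonneg_of_nonpos hN hx
  simp [ramp, this]

lemma ramp_pos {N x : ℝ} (hN : 0 < N) (hx : 0 < x) : 0 < ramp N x := by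
  have : 0 < N * x := mul_pos hN hx
  simp [ramp, this]

lemma ramp_nonneg (N x : ℝ) : 0 ≤ ramp N x := by simp [ramp]

lemma ramp_le_one (N x : ℝ) : ramp N x ≤ 1 := by simp [ramp]

lemma ramp_mono {N x y : ℝ} (hN : 0 ≤ N) (hxy : x ≤ y) : ramp N x ≤ ramp N y := by
  unfold ramp
  gcongr

lemma abs_ramp_sub_le {N : ℝ} (hN : 0 ≤ N) (x y : ℝ) : |ramp N x - ramp N y| ≤ N * |x - y| := by
  unfold ramp
  calc _ ≤ max |max (N * x) 0 - max (N * y) 0| |(1 : ℝ) - 1| := abs_min_sub_min_le_max _ _ _ _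
    _ ≤ |N * x - N * y| := by
      simp only [sub_self, abs_zero]
      exact max_le (abs_max_sub_max_le_abs _ _ _) (abs_nonneg _)
    _ = _ := by rw [← mul_sub, abs_mul, abs_of_nonneg hN]

lemma continuous_ramp (N : ℝ) : Continuous (ramp N) := by
  unfold ramp
  fun_prop

lemma tendsto_ramp {x : ℝ} (hx : 0 < x) :
    Tendsto (fun n : ℕ => ramp (n + 1) x) atTop (𝓝 1) := by
  have h : Tendsto (fun n : ℕ => ((n : ℝ) + 1) * x) atTop atTop :=
    (tendsto_atTop_add_const_right _ _ tendsto_natCast_atTop_atTop).atTop_mul_const hx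
  refine tendsto_const_nhds.congr' ?_
  filter_upwards [h.eventually_ge_atTop 1] with n hn
  unfold ramp
  rw [max_eq_left (by linarith), min_eq_right hn]

/-- For `c ≥ 0` these Lipschitz functions are positive on `(0,∞)` and tend to the indicator
function of `(0,c)`, except at `c`. -/
noncomputable def plateau (n : ℕ) (c x : ℝ) : ℝ :=
  ramp (n + 1) x - (1 - 1 / ((n : ℝ) + 1)) * ramp (n + 1) (x - c)

lemma one_sub_one_div_mem (n : ℕ) : 1 - 1 / ((n : ℝ) + 1) ∈ Ico (0 : ℝ) 1 := by
  have h : (0 : ℝ) < n + 1 := by positivity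
  refine ⟨?_, by simpa using h⟩
  rw [sub_nonneg, div_le_one h]
  linarith [Nat.cast_nonneg (α := ℝ) n]

/-- The factor `1 - 1/(n+1) < 1` leaves a positive remainder beyond `c`; the minimum principle needs
a strictly positive density. -/
lemma plateau_pos (n : ℕ) {c x : ℝ} (hc : 0 ≤ c) (hx : 0 < x) : 0 < plateau n c x := by
  have h1 := ramp_pos (N := n + 1) (by positivity) hx
  have h2 := ramp_mono (N := n + 1) (by positivity) (show x - c ≤ x by linarith)
  have h3 := one_sub_one_div_mem n
  have h4 := ramp_nonneg (n + 1) (x - c)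
  unfold plateau
  nlinarith [h3.1, h3.2]

lemma plateau_of_nonpos (n : ℕ) {c x : ℝ} (hc : 0 ≤ c) (hx : x ≤ 0) : plateau n c x = 0 := by
  have hn : (0 : ℝ) ≤ n + 1 := by positivity
  simp [plateau, ramp_of_nonpos hn hx, ramp_of_nonpos hn (show x - c ≤ 0 by linarith)]

lemma continuous_plateau (n : ℕ) (c : ℝ) : Continuous (plateau n c) := by
  have := continuous_ramp (n + 1)
  unfold plateau
  fun_prop

lemma abs_plateau_le (n : ℕ) (c x : ℝ) : |plateau n c x| ≤ 1 := by
  have h3 := one_sub_one_div_mem n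
  have h1 := ramp_nonneg (n + 1) x
  have h2 := ramp_le_one (n + 1) x
  have h4 := ramp_nonneg (n + 1) (x - c)
  have h5 := ramp_le_one (n + 1) (x - c)
  unfold plateau
  rw [abs_le]
  constructor <;> nlinarith [h3.1, h3.2]

lemma abs_plateau_sub_le (n : ℕ) (c x y : ℝ) :
    |plateau n c x - plateau n c y| ≤ (2 * (n + 1)) * |x - y| := by
  have hn : (0 : ℝ) ≤ n + 1 := by positivity
  have h3 := one_sub_one_div_mem n
  have h1 := abs_ramp_sub_le hn x y
  have h2 := abs_ramp_sub_le hn (x - c) (y - c)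
  rw [sub_sub_sub_cancel_right] at h2
  have e : plateau n c x - plateau n c y = (ramp (n + 1) x - ramp (n + 1) y)
    - (1 - 1 / ((n : ℝ) + 1)) * (ramp (n + 1) (x - c) - ramp (n + 1) (y - c)) := by
    unfold plateau; ring
  rw [e]
  refine (abs_sub _ _).trans ?_
  rw [abs_mul, abs_of_nonneg h3.1]
  nlinarith [h3.1, h3.2, abs_nonneg (ramp (n + 1) (x - c) - ramp (n + 1) (y - c))]

lemma tendsto_plateau {c x : ℝ} (hc : 0 ≤ c) (hx : x ≠ c) :
    Tendsto (fun n => plateau n c x) atTop (𝓝 ((Ioo 0 c).indicator (fun _ => 1) x)) := by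
  rcases le_or_gt x 0 with h0 | h0
  · have : x ∉ Ioo 0 c := fun h => by linarith [h.1]
    simp [this, plateau_of_nonpos _ hc h0]
  have h1 := tendsto_ramp h0
  rcases lt_or_gt_of_ne hx with h | h
  · have h2 : ∀ n : ℕ, ramp (n + 1) (x - c) = 0 := fun n =>
      ramp_of_nonpos (by positivity) (by linarith)
    rw [indicator_of_mem (show x ∈ Ioo 0 c from ⟨h0, h⟩)]
    simpa [plateau, h2] using h1
  · have h2 := tendsto_ramp (show 0 < x - c by linarith)
    have h3 : x ∉ Ioo 0 c := fun h => by linarith [h.2]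
    rw [indicator_of_notMem h3]
    have h4 : Tendsto (fun n : ℕ => 1 - 1 / ((n : ℝ) + 1)) atTop (𝓝 1) := by
      simpa using tendsto_one_div_add_atTop_nhds_zero_nat.const_sub (1 : ℝ)
    simpa [plateau] using h1.sub (h4.mul h2)

namespace IsPC

variable {k l : ℝ → ℝ}

/-- The minimum principle applies to `v = l ∗ plateau`, which is Lipschitz and satisfies `k ∗ v = ∫
plateau`. -/
lemma conv_plateau_nonneg (h : IsPC k l) (n : ℕ) {c t : ℝ} (hc : 0 ≤ c) (ht : 0 ≤ t) :
    0 ≤ conv l (plateau n c) t := by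
  have ht' : t ∈ Icc 0 t := ⟨ht, le_rfl⟩
  refine nonneg_of_conv_eq_integral (g := plateau n c) (h.integrableOn_left t) h.nonneg h.antitone
    (conv_apply_zero _ _)
    (fun s hs t ht => abs_conv_sub_le (h.integrableOn_right _)
      (fun x hx => plateau_of_nonpos n hc hx) (continuous_plateau n c)
      (abs_plateau_sub_le n c) hs ht)
    (continuous_plateau n c).continuousOn (fun s hs => plateau_pos n hc hs.1)
    (fun s hs => h.conv_left_conv_right (continuous_plateau n c).aestronglyMeasurable
      (fun x _ => abs_plateau_le n c x) hs) ht'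

/-- As `n → ∞`, the plateau of width `t - s` tends to the indicator of `(0, t - s)`, so `(l ∗
plateau)(t)` tends to `∫ₛᵗ l`. -/
lemma integral_right_nonneg (h : IsPC k l) {s t : ℝ} (hs : 0 ≤ s) (hst : s ≤ t) :
    0 ≤ ∫ x in s..t, l x := by
  have ht : 0 ≤ t := hs.trans hst
  have hc : 0 ≤ t - s := by linarith
  have hlim : Tendsto (fun n => conv l (plateau n (t - s)) t) atTop
      (𝓝 (∫ x in (0 : ℝ)..t, (Ioc s t).indicator l x)) := by
    have e : ∀ n, conv l (plateau n (t - s)) t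
        = ∫ x in (0 : ℝ)..t, l x * plateau n (t - s) (t - x) := fun n => by
      rw [conv_comm, conv]
      exact intervalIntegral.integral_congr fun s _ => mul_comm _ _
    simp only [e]
    have hl : IntervalIntegrable l volume 0 t :=
      (intervalIntegrable_iff_integrableOn_Ioc_of_le ht).2 (h.integrableOn_right t)
    refine intervalIntegral.tendsto_integral_filter_of_dominated_convergence (fun x => |l x|)
      (Eventually.of_forall fun n => ?_) (Eventually.of_forall fun n =>
        Eventually.of_forall fun x _ => ?_) hl.abs ?_
    · refine hl.aestronglyMeasurable_restrict_uIoc.mul (Continuous.aestronglyMeasurable ?_)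
      exact (continuous_plateau n _).comp (by fun_prop)
    · rw [norm_mul]
      exact mul_le_of_le_one_right (norm_nonneg _) (abs_plateau_le _ _ _)
    · have hne : ∀ᵐ x : ℝ, x ≠ s ∧ x ≠ t := by
        have h1 : ∀ᵐ x : ℝ, x ≠ s := by simp [ae_iff]
        have h2 : ∀ᵐ x : ℝ, x ≠ t := by simp [ae_iff]
        filter_upwards [h1, h2] with x a b using ⟨a, b⟩
      filter_upwards [hne] with x hx _
      have hx1 : t - x ≠ t - s := fun h => hx.1 (by linarith)
      have := (tendsto_plateau hc hx1).const_mul (l x)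
      by_cases hm : x ∈ Ioc s t
      · have hm' : t - x ∈ Ioo 0 (t - s) :=
          ⟨sub_pos.2 (lt_of_le_of_ne hm.2 hx.2), by linarith [hm.1]⟩
        simpa [hm, hm'] using this
      · have hm' : t - x ∉ Ioo 0 (t - s) := fun h' =>
          hm ⟨by linarith [h'.2], by linarith [h'.1]⟩
        simpa [hm, hm'] using this
  have h0 := ge_of_tendsto' hlim fun n => h.conv_plateau_nonneg n hc ht
  rw [intervalIntegral.integral_of_le ht, setIntegral_indicator measurableSet_Ioc,
    inter_eq_right.2 (Ioc_subset_Ioc_left hs)] at h0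
  rwa [intervalIntegral.integral_of_le hst]

/-- The kernel `l` of a pair in `PC` is nonnegative. -/
lemma right_nonneg (h : IsPC k l) : ∀ᵐ t : ℝ, 0 < t → 0 ≤ l t := by
  have key : ∀ n : ℕ, ∀ᵐ t : ℝ, t ∈ Ioo (0 : ℝ) n → 0 ≤ l t := by
    intro n
    have hl : IntervalIntegrable l volume 0 n :=
      (intervalIntegrable_iff_integrableOn_Ioc_of_le (Nat.cast_nonneg n)).2
        (h.integrableOn_right n)
    -- By Lebesgue differentiation `l` is almost everywhere the derivative of its primitive, which
    -- is nondecreasing.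
    filter_upwards [hl.ae_hasDerivAt_integral] with t ht htn
    have htu : t ∈ uIcc (0 : ℝ) n := by
      rw [uIcc_of_le (Nat.cast_nonneg n)]; exact ⟨htn.1.le, htn.2.le⟩
    have hd := ht htu 0 (by simp)
    have hmono : MonotoneOn (fun x => ∫ y in (0 : ℝ)..x, l y) (Ioo (0 : ℝ) n) := by
      intro x hx y hy hxy
      have hx' : x ∈ Icc (0 : ℝ) n := ⟨hx.1.le, hx.2.le⟩
      have hy' : y ∈ Icc (0 : ℝ) n := ⟨hy.1.le, hy.2.le⟩
      have h0' : (0 : ℝ) ∈ Icc (0 : ℝ) n := ⟨le_rfl, Nat.cast_nonneg n⟩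
      have e := intervalIntegral.integral_interval_sub_left
        (IntegrableOn.intervalIntegrable_of_mem (h.integrableOn_right n) h0' hy')
        (IntegrableOn.intervalIntegrable_of_mem (h.integrableOn_right n) h0' hx')
      have := h.integral_right_nonneg hx'.1 hxy
      dsimp only
      linarith
    have := hmono.derivWithin_nonneg (x := t)
    rwa [derivWithin_of_isOpen isOpen_Ioo htn, hd.deriv] at this
  filter_upwards [ae_all_iff.2 key] with t ht h0
  obtain ⟨n, hn⟩ := exists_nat_gt t
  exact ht n ⟨h0, hn⟩

end IsPC

/-! ### Order properties of convolution with `l` -/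

lemma conv_eq_setIntegral (b c : ℝ → ℝ) {t : ℝ} (ht : 0 ≤ t) :
    conv b c t = ∫ s in Ioc 0 t, b s * c (t - s) := by
  rw [conv_comm, conv, intervalIntegral.integral_of_le ht]
  simp only [mul_comm (c _)]

namespace IsPC

variable {k l : ℝ → ℝ}

lemma right_nonneg_restrict (h : IsPC k l) (s : Set ℝ) (hs : s ⊆ Ioi 0) :
    0 ≤ᵐ[volume.restrict s] l :=
  ae_restrict_of_ae_restrict_of_subset hs
    ((ae_restrict_iff' measurableSet_Ioi).2 h.right_nonneg)

/-- Comparison of `l ∗ F` at `s` with `l ∗ G` at `t ≥ s`. -/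
lemma conv_le_conv (h : IsPC k l) {F G : ℝ → ℝ} {A C D s t : ℝ}
    (hF : AEStronglyMeasurable F (volume.restrict (Ioc 0 A))) (hFC : ∀ x ∈ Ioc 0 A, |F x| ≤ C)
    (hG : AEStronglyMeasurable G (volume.restrict (Ioc 0 A))) (hGD : ∀ x ∈ Ioc 0 A, |G x| ≤ D)
    (hs : 0 ≤ s) (hst : s ≤ t) (htA : t ≤ A)
    (hFG : ∀ x ∈ Ioo 0 s, F (s - x) ≤ G (t - x)) (hG0 : ∀ x ∈ Ioo 0 (t - s), 0 ≤ G x) :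
    conv l F s ≤ conv l G t := by
  have ms : s ∈ Icc 0 A := ⟨hs, hst.trans htA⟩
  have mt : t ∈ Icc 0 A := ⟨hs.trans hst, htA⟩
  have iF := integrableOn_conv_integrand (h.integrableOn_right A) hF hFC ms
  have iG := integrableOn_conv_integrand (h.integrableOn_right A) hG hGD mt
  rw [conv_eq_setIntegral _ _ hs, conv_eq_setIntegral _ _ mt.1]
  have hsplit : Ioc 0 t = Ioc 0 s ∪ Ioc s t := (Ioc_union_Ioc_eq_Ioc hs hst).symm
  rw [hsplit, setIntegral_union (Ioc_disjoint_Ioc_of_le le_rfl) measurableSet_Ioc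
    (iG.mono_set (Ioc_subset_Ioc_right hst)) (iG.mono_set (Ioc_subset_Ioc_left hs))]
  have h1 : ∫ x in Ioc 0 s, l x * F (s - x) ≤ ∫ x in Ioc 0 s, l x * G (t - x) := by
    rw [← restrict_Ioo_eq_restrict_Ioc]
    refine integral_mono_ae (iF.mono_set Ioo_subset_Ioc_self)
      (iG.mono_set (Ioo_subset_Ioc_self.trans (Ioc_subset_Ioc_right hst))) ?_
    filter_upwards [h.right_nonneg_restrict (Ioo 0 s) Ioo_subset_Ioi_self,
      ae_restrict_mem measurableSet_Ioo] with x hx hx'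
    exact mul_le_mul_of_nonneg_left (hFG x hx') hx
  have h2 : 0 ≤ ∫ x in Ioc s t, l x * G (t - x) := by
    rw [← restrict_Ioo_eq_restrict_Ioc]
    refine integral_nonneg_of_ae ?_
    filter_upwards [h.right_nonneg_restrict (Ioo s t) fun x hx => lt_of_le_of_lt hs hx.1,
      ae_restrict_mem measurableSet_Ioo] with x hx hx'
    exact mul_nonneg hx (hG0 _ ⟨by linarith [hx'.2], by linarith [hx'.1]⟩)
  linarith

/-- The increment from `s` to `t` is `∫₀ˢ l(x) (F(t-x) - F(s-x)) dx + ∫ₛᵗ l(x) F(t-x) dx`, and both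
terms are nonnegative. -/
lemma conv_monotoneOn (h : IsPC k l) {F : ℝ → ℝ} {A : ℝ} (hF : MonotoneOn F (Icc 0 A))
    (hF0 : ∀ x ∈ Icc 0 A, 0 ≤ F x) : MonotoneOn (conv l F) (Icc 0 A) := by
  intro s hs t ht hst
  have hm : AEStronglyMeasurable F (volume.restrict (Ioc 0 A)) :=
    (aemeasurable_restrict_of_monotoneOn measurableSet_Ioc
      (hF.mono Ioc_subset_Icc_self)).aestronglyMeasurable
  have hA : A ∈ Icc 0 A := ⟨hs.1.trans hs.2, le_rfl⟩
  have hb : ∀ x ∈ Ioc 0 A, |F x| ≤ F A := fun x hx => by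
    rw [abs_of_nonneg (hF0 x (Ioc_subset_Icc_self hx))]
    exact hF (Ioc_subset_Icc_self hx) hA hx.2
  refine h.conv_le_conv hm hb hm hb hs.1 hst ht.2 (fun x hx => ?_) fun x hx =>
    hF0 x ⟨hx.1.le, by linarith [hx.2, hs.1, ht.2]⟩
  exact hF ⟨by linarith [hx.2], by linarith [hx.1, hs.2]⟩
    ⟨by linarith [hx.2], by linarith [hx.1, ht.2]⟩ (by linarith)

/-! ### The primitive of `l`: subadditivity and rearrangement -/

lemma intervalIntegrable_left (h : IsPC k l) {s t : ℝ} (hs : 0 ≤ s) (ht : 0 ≤ t) :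
    IntervalIntegrable k volume s t :=
  IntegrableOn.intervalIntegrable_of_mem (h.integrableOn_left (max s t))
    ⟨hs, le_max_left _ _⟩ ⟨ht, le_max_right _ _⟩

lemma intervalIntegrable_right (h : IsPC k l) {s t : ℝ} (hs : 0 ≤ s) (ht : 0 ≤ t) :
    IntervalIntegrable l volume s t :=
  IntegrableOn.intervalIntegrable_of_mem (h.integrableOn_right (max s t))
    ⟨hs, le_max_left _ _⟩ ⟨ht, le_max_right _ _⟩

lemma monotoneOn_integral_right (h : IsPC k l) :
    MonotoneOn (fun t => ∫ s in (0 : ℝ)..t, l s) (Ici 0) := by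
  intro s hs t ht hst
  have e := intervalIntegral.integral_interval_sub_left
    (h.intervalIntegrable_right le_rfl ht) (h.intervalIntegrable_right le_rfl hs)
  have := h.integral_right_nonneg hs hst
  dsimp only
  linarith

lemma continuousOn_integral_right (h : IsPC k l) (A : ℝ) :
    ContinuousOn (fun t => ∫ s in (0 : ℝ)..t, l s) (Icc 0 A) :=
  continuousOn_primitive_of_integrableOn (h.integrableOn_right A)

lemma conv_left_integral_right (h : IsPC k l) {t : ℝ} (ht : 0 ≤ t) :
    conv k (fun t => ∫ s in (0 : ℝ)..t, l s) t = t := by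
  have := h.conv_left_conv_right (A := t) (c := fun _ => 1) (C := 1) (t := t)
    aestronglyMeasurable_const (by simp) ⟨ht, le_rfl⟩
  simpa [conv_one_right, funext (conv_one_right l)] using this

/-- The primitive of `l` is subadditive. -/
lemma integral_right_add_le (h : IsPC k l) {s t : ℝ} (hs : 0 ≤ s) (ht : 0 ≤ t) :
    ∫ x in (0 : ℝ)..(t + s), l x ≤ (∫ x in (0 : ℝ)..t, l x) + ∫ x in (0 : ℝ)..s, l x := by
  set L : ℝ → ℝ := fun t => ∫ x in (0 : ℝ)..t, l x with hL
  change L (t + s) ≤ L t + L s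
  have hLmono : MonotoneOn L (Ici 0) := h.monotoneOn_integral_right
  have hL0 : L 0 = 0 := by simp [hL]
  have hLnn : ∀ x, 0 ≤ x → 0 ≤ L x := fun x hx => hL0 ▸ hLmono self_mem_Ici hx hx
  have hLc : ∀ A, ContinuousOn L (Icc 0 A) := h.continuousOn_integral_right
  rcases hs.eq_or_lt with rfl | hs0
  · simp [hL0]
  set z : ℝ → ℝ := fun x => L (t + x) - L t - L x with hz
  suffices z s ≤ 0 by simp only [hz] at this; linarith
  -- The extra unit makes `s` an interior point of `[0,B]`, so that the primitive of `z` can be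
  -- differentiated there.
  set B := s + 1 with hB
  have hB0 : 0 ≤ B := by linarith
  have hLtc : ContinuousOn (fun x => L (t + x)) (Icc 0 B) :=
    (hLc (t + B)).comp (by fun_prop) fun x hx => ⟨by linarith [hx.1], by linarith [hx.2]⟩
  have hzc : ContinuousOn z (Icc 0 B) := (hLtc.sub continuousOn_const).sub (hLc B)
  obtain ⟨C, hC⟩ := isCompact_Icc.exists_bound_of_continuousOn hzc
  have hzb : ∀ x ∈ Ioc 0 B, |z x| ≤ C := fun x hx => hC x (Ioc_subset_Icc_self hx)
  have hzm : AEStronglyMeasurable z (volume.restrict (Ioc 0 B)) :=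
    (hzc.mono Ioc_subset_Icc_self).aestronglyMeasurable measurableSet_Ioc
  set K : ℝ → ℝ := fun t => ∫ x in (0 : ℝ)..t, k x with hK
  have ik : ∀ x y, 0 ≤ x → 0 ≤ y → IntervalIntegrable k volume x y := fun x y hx hy =>
    h.intervalIntegrable_left hx hy
  have hrev : ∀ T, 0 ≤ T → ContinuousOn (fun x => L (T - x)) (Icc 0 T) := fun T hT =>
    (hLc T).comp (by fun_prop) fun x hx => ⟨by linarith [hx.2], by linarith [hx.1]⟩
  have iks : ∀ x, 0 ≤ x → IntervalIntegrable (fun y => k (y + x)) volume 0 t := fun x hx => by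
    have := (ik x (t + x) hx (by linarith)).comp_add_right x
    simpa only [sub_self, add_sub_cancel_right] using this
  have hrevt : ContinuousOn (fun x => L (t - x)) (uIcc 0 t) := by
    rw [uIcc_of_le ht]; exact hrev t ht
  -- Splitting `(k ∗ L)(t + x) = t + x` at `x` and subtracting `(k ∗ L)(x) = x` leaves only terms
  -- monotone in `x`.
  have hconv : ∀ x ∈ Icc 0 B,
      conv k z x = t - (∫ y in (0 : ℝ)..t, k (y + x) * L (t - y)) - L t * K x := by
    intro x hx
    have htx : 0 ≤ t + x := by linarith [hx.1]
    have i1 : ∀ a ∈ Icc 0 (t + x), ∀ b ∈ Icc 0 (t + x),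
        IntervalIntegrable (fun y => k y * L (t + x - y)) volume a b := fun a ha b hb =>
      (ik _ _ ha.1 hb.1).mul_continuousOn ((hrev _ htx).mono (uIcc_subset_Icc ha hb))
    have e := conv_eq_split k L (t := t + x) (h := x)
      (i1 _ ⟨le_rfl, htx⟩ _ ⟨hx.1, by linarith⟩) (i1 _ ⟨hx.1, by linarith⟩ _ ⟨htx, le_rfl⟩)
    rw [h.conv_left_integral_right htx, add_sub_cancel_right] at e
    have e2 := h.conv_left_integral_right hx.1
    change conv k L x = x at e2
    have r : ∀ v : ℝ → ℝ, conv k v x = ∫ y in (0 : ℝ)..x, k y * v (x - y) := fun v => by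
      rw [conv_comm, conv]
      exact intervalIntegral.integral_congr fun s _ => mul_comm _ _
    have j1 : IntervalIntegrable (fun y => k y * L (t + x - y)) volume 0 x :=
      i1 _ ⟨le_rfl, htx⟩ _ ⟨hx.1, by linarith⟩
    have j2 : IntervalIntegrable (fun y => k y * L t) volume 0 x := (ik _ _ le_rfl hx.1).mul_const _
    have j3 : IntervalIntegrable (fun y => k y * L (x - y)) volume 0 x :=
      (ik _ _ le_rfl hx.1).mul_continuousOn (by rw [uIcc_of_le hx.1]; exact hrev x hx.1)
    have e3 : conv k z x = (∫ y in (0 : ℝ)..x, k y * L (t + x - y)) - K x * L t - conv k L x := by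
      rw [r z, r L, hK, ← intervalIntegral.integral_mul_const, ← intervalIntegral.integral_sub j1 j2,
        ← intervalIntegral.integral_sub (j1.sub j2) j3]
      refine intervalIntegral.integral_congr fun y _ => ?_
      simp only [hz]
      rw [show t + (x - y) = t + x - y by ring]
      ring
    rw [e3, e2]
    linarith
  -- For `x ≤ y`, replacing `L(t - w)` by the larger `L(t)` bounds the increment by `L(t) (K(t+x) -
  -- K(t+y)) ≤ 0`.
  have hanti : AntitoneOn (conv k z) (Icc 0 B) := by
    intro x hx y hy hxy
    rw [hconv x hx, hconv y hy]
    have i1 := (iks x hx.1).mul_continuousOn hrevt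
    have i2 := (iks y hy.1).mul_continuousOn hrevt
    have hle : (∫ w in (0 : ℝ)..t, (k (w + x) * L (t - w) - k (w + y) * L (t - w)))
        ≤ ∫ w in (0 : ℝ)..t, (k (w + x) - k (w + y)) * L t := by
      refine intervalIntegral.integral_mono_on_of_le_Ioo ht (i1.sub i2)
        (((iks x hx.1).sub (iks y hy.1)).mul_const _) fun w hw => ?_
      rw [← sub_mul]
      have hw1 := hw.1
      refine mul_le_mul_of_nonneg_left (hLmono ?_ ht (by linarith)) (sub_nonneg.2 ?_)
      · exact sub_nonneg.2 hw.2.le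
      · exact h.antitone (show (0 : ℝ) < w + x by linarith [hx.1])
          (show (0 : ℝ) < w + y by linarith [hy.1]) (by linarith)
    rw [intervalIntegral.integral_mul_const, intervalIntegral.integral_sub i1 i2,
      intervalIntegral.integral_sub (iks x hx.1) (iks y hy.1)] at hle
    have sh : ∀ x, 0 ≤ x → (∫ w in (0 : ℝ)..t, k (w + x)) = K (t + x) - K x := fun x hx => by
      rw [hK, intervalIntegral.integral_interval_sub_left (ik _ _ le_rfl (by linarith))
        (ik _ _ le_rfl hx)]
      simp
    rw [sh x hx.1, sh y hy.1] at hle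
    have hKm : K (t + x) ≤ K (t + y) := by
      have e := intervalIntegral.integral_interval_sub_left
        (ik 0 (t + y) le_rfl (by linarith [hy.1])) (ik 0 (t + x) le_rfl (by linarith [hx.1]))
      have : 0 ≤ ∫ w in (t + x)..(t + y), k w := by
        refine intervalIntegral.integral_nonneg_of_ae_restrict (by linarith) ?_
        rw [← restrict_Ioc_eq_restrict_Icc]
        filter_upwards [ae_restrict_mem measurableSet_Ioc] with w hw
        exact h.nonneg w (show (0 : ℝ) < w by linarith [hw.1, hx.1])
      simp only [hK]
      linarith
    nlinarith [hLnn t ht]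
  have hk0 : conv k z 0 = 0 := conv_apply_zero _ _
  have hmono := h.conv_monotoneOn (F := fun x => -conv k z x) (A := B)
    (fun x hx y hy hxy => neg_le_neg (hanti hx hy hxy))
    (fun x hx => by
      have := hanti ⟨le_rfl, hB0⟩ hx hx.1
      rw [hk0] at this
      linarith)
  have hprim : ∀ x ∈ Icc 0 B, conv l (fun x => -conv k z x) x = -∫ y in (0 : ℝ)..x, z y := by
    intro x hx
    rw [← h.conv_right_conv_left hzm hzb hx, conv, conv, ← intervalIntegral.integral_neg]
    simp only [mul_neg]
  -- Convolving the nondecreasing function `-(k ∗ z) ≥ 0` with `l` gives `-∫₀ˣ z`, which is thus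
  -- nondecreasing; its derivative at `s` is `-z(s)`.
  have hms : MonotoneOn (fun x => -∫ y in (0 : ℝ)..x, z y) (Ioo 0 B) := fun x hx y hy hxy => by
    have := hmono (Ioo_subset_Icc_self hx) (Ioo_subset_Icc_self hy) hxy
    rwa [hprim _ (Ioo_subset_Icc_self hx), hprim _ (Ioo_subset_Icc_self hy)] at this
  have hsB : s ∈ Ioo 0 B := ⟨hs0, by linarith⟩
  have hd : HasDerivAt (fun x => ∫ y in (0 : ℝ)..x, z y) (z s) s := by
    refine intervalIntegral.integral_hasDerivAt_right
      (hzc.mono (uIcc_subset_Icc ⟨le_rfl, hB0⟩ (Ioo_subset_Icc_self hsB))).intervalIntegrable ?_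
      (hzc.continuousAt (Icc_mem_nhds hsB.1 hsB.2))
    exact (hzc.mono Ioo_subset_Icc_self).stronglyMeasurableAtFilter isOpen_Ioo s hsB
  have hdn := hms.derivWithin_nonneg (x := s)
  rw [derivWithin_of_isOpen isOpen_Ioo hsB, hd.fun_neg.deriv] at hdn
  linarith

/-- The rearrangement inequality behind the blow-up estimate: for nondecreasing `F ≥ 0`,
`∫₀ᵗ l F ≤ (l ∗ F)(t)`, by subadditivity of the primitive of `l`. -/
lemma integral_mul_le_conv (h : IsPC k l) {F : ℝ → ℝ} (hF : Monotone F) (hF0 : ∀ x, 0 ≤ F x)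
    {t : ℝ} (ht : 0 ≤ t) : ∫ s in (0 : ℝ)..t, l s * F s ≤ conv l F t := by
  have il : IntegrableOn l (Ioo 0 t) := (h.integrableOn_right t).mono_set Ioo_subset_Ioc_self
  have hlnn : 0 ≤ᵐ[volume.restrict (Ioo 0 t)] l :=
    h.right_nonneg_restrict _ Ioo_subset_Ioi_self
  have hsub : ∀ r, 0 ≤ r → r ≤ t → IntervalIntegrable (fun s => l (t - s)) volume r t := by
    intro r hr hrt
    have := (h.intervalIntegrable_right (s := t - r) (t := 0) (by linarith) le_rfl).comp_sub_left t
    simpa using this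
  have hrl : IntegrableOn (fun s => l (t - s)) (Ioo 0 t) :=
    ((intervalIntegrable_iff_integrableOn_Ioo_of_le ht).1 (hsub 0 le_rfl ht))
  have hrnn : ∀ᵐ s, s ∈ Ioo 0 t → 0 ≤ l (t - s) := by
    have := (quasiMeasurePreserving_sub_left_of_right_invariant volume t).ae h.right_nonneg
    filter_upwards [this] with s hs hs' using hs (by linarith [hs'.2])
  have hrnn' : 0 ≤ᵐ[volume.restrict (Ioo 0 t)] fun s => l (t - s) :=
    (ae_restrict_iff' measurableSet_Ioo).2 hrnn
  have hFb : ∀ᵐ s ∂(volume.restrict (Ioo 0 t)), ‖F s‖ ≤ F t :=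
    (ae_restrict_mem measurableSet_Ioo).mono fun s hs => by
      rw [Real.norm_of_nonneg (hF0 s)]; exact hF hs.2.le
  have hFm : AEStronglyMeasurable F (volume.restrict (Ioo 0 t)) :=
    hF.measurable.aestronglyMeasurable
  -- Layer-cake formula for `F` with respect to the measure of density `g`; it is applied to `g = l`
  -- and to its reflection `s ↦ l(t - s)`.
  have key : ∀ g : ℝ → ℝ, IntegrableOn g (Ioo 0 t) → 0 ≤ᵐ[volume.restrict (Ioo 0 t)] g →
      ENNReal.ofReal (∫ s in Ioo 0 t, g s * F s)
        = ∫⁻ r in Ioi 0, ∫⁻ s in {a | r < F a} ∩ Ioo 0 t, ENNReal.ofReal (g s) := by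
    intro g hg hgnn
    have hgF : IntegrableOn (fun s => g s * F s) (Ioo 0 t) := Integrable.mul_bdd hg hFm hFb
    rw [ofReal_integral_eq_lintegral_ofReal hgF (hgnn.mono fun s hs => mul_nonneg hs (hF0 s))]
    set μ := (volume.restrict (Ioo 0 t)).withDensity fun s => ENNReal.ofReal (g s) with hμ
    have hgm : AEMeasurable (fun s => ENNReal.ofReal (g s)) (volume.restrict (Ioo 0 t)) :=
      hg.aestronglyMeasurable.aemeasurable.ennreal_ofReal
    have e1 : ∫⁻ s, ENNReal.ofReal (F s) ∂μ
        = ∫⁻ s in Ioo 0 t, ENNReal.ofReal (g s * F s) := by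
      rw [hμ, lintegral_withDensity_eq_lintegral_mul₀ hgm
        hF.measurable.ennreal_ofReal.aemeasurable]
      refine lintegral_congr_ae (hgnn.mono fun s hs => ?_)
      simp only [Pi.mul_apply]
      rw [ENNReal.ofReal_mul hs]
    rw [← e1, lintegral_eq_lintegral_meas_lt μ (Eventually.of_forall hF0)
      hF.measurable.aemeasurable]
    refine lintegral_congr fun r => ?_
    have hm : MeasurableSet {a | r < F a} := measurableSet_lt measurable_const hF.measurable
    rw [hμ, withDensity_apply _ hm, Measure.restrict_restrict hm]
  have hint : ∀ g : ℝ → ℝ, ∀ r, 0 ≤ r → r ≤ t → IntegrableOn g (Ioo 0 t) →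
      0 ≤ᵐ[volume.restrict (Ioo 0 t)] g →
      ∫⁻ s in Ioo r t, ENNReal.ofReal (g s) = ENNReal.ofReal (∫ s in r..t, g s) := by
    intro g r hr hrt hg hgnn
    have hs : Ioo r t ⊆ Ioo 0 t := Ioo_subset_Ioo_left hr
    rw [intervalIntegral.integral_of_le hrt, integral_Ioc_eq_integral_Ioo,
      ofReal_integral_eq_lintegral_ofReal (hg.mono_set hs)
        (ae_restrict_of_ae_restrict_of_subset hs hgnn)]
  have hmain : ENNReal.ofReal (∫ s in Ioo 0 t, l s * F s)
      ≤ ENNReal.ofReal (∫ s in Ioo 0 t, l (t - s) * F s) := by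
    rw [key _ il hlnn, key _ hrl hrnn']
    refine lintegral_mono fun r => ?_
    dsimp only
    rcases eq_empty_or_nonempty ({a | r < F a} ∩ Ioo 0 t) with he | hne
    · simp [he]
    -- As `F` is nondecreasing, its superlevel set in `(0,t)` is, up to its left endpoint `ρ`, the
    -- interval `(ρ,t)`. The comparison becomes `L(t) - L(ρ) ≤ L(t - ρ)`.
    set U := {a | r < F a} ∩ Ioo 0 t with hU
    have hbdd : BddBelow U := ⟨0, fun x hx => hx.2.1.le⟩
    set ρ := sInf U with hρ
    have hρ0 : 0 ≤ ρ := le_csInf hne fun x hx => hx.2.1.le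
    obtain ⟨x₀, hx₀⟩ := hne
    have hρt : ρ ≤ t := (csInf_le hbdd hx₀).trans hx₀.2.2.le
    have h1 : Ioo ρ t ⊆ U := fun x hx => by
      obtain ⟨y, hy, hyx⟩ := exists_lt_of_csInf_lt ⟨x₀, hx₀⟩ hx.1
      exact ⟨lt_of_lt_of_le hy.1 (hF hyx.le), lt_of_le_of_lt hρ0 hx.1, hx.2⟩
    have h2 : U ⊆ Ico ρ t := fun x hx => ⟨csInf_le hbdd hx, hx.2.2⟩
    calc ∫⁻ s in U, ENNReal.ofReal (l s) ≤ ∫⁻ s in Ico ρ t, ENNReal.ofReal (l s) :=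
          lintegral_mono_set h2
      _ = ∫⁻ s in Ioo ρ t, ENNReal.ofReal (l s) := by rw [restrict_Ioo_eq_restrict_Ico]
      _ = ENNReal.ofReal (∫ s in ρ..t, l s) := hint _ _ hρ0 hρt il hlnn
      _ ≤ ENNReal.ofReal (∫ s in ρ..t, l (t - s)) := by
          refine ENNReal.ofReal_le_ofReal ?_
          have hsa := h.integral_right_add_le (s := t - ρ) (t := ρ) (by linarith) hρ0
          rw [add_sub_cancel] at hsa
          have e := intervalIntegral.integral_interval_sub_left
            (h.intervalIntegrable_right le_rfl ht) (h.intervalIntegrable_right le_rfl hρ0)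
          simp only [intervalIntegral.integral_comp_sub_left, sub_self]
          linarith
      _ = ∫⁻ s in Ioo ρ t, ENNReal.ofReal (l (t - s)) := (hint _ _ hρ0 hρt hrl hrnn').symm
      _ ≤ _ := lintegral_mono_set h1
  have hnn : 0 ≤ ∫ s in Ioo 0 t, l (t - s) * F s :=
    integral_nonneg_of_ae (hrnn'.mono fun s hs => mul_nonneg hs (hF0 s))
  rw [conv, intervalIntegral.integral_of_le ht, intervalIntegral.integral_of_le ht,
    integral_Ioc_eq_integral_Ioo, integral_Ioc_eq_integral_Ioo]
  exact (ENNReal.ofReal_le_ofReal_iff hnn).1 hmain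

end IsPC

/-! ### The Volterra equation: uniqueness and solvability for bounded nonlinearities -/

namespace IsPC

variable {k l : ℝ → ℝ}

/-- By dominated convergence the weighted integral tends to `0` as `ω → ∞`. With `C` a Lipschitz
constant, this makes the Volterra operator a contraction for the norm `sup e^{-ωt} |w(t)|`. -/
lemma exists_exp_weight (h : IsPC k l) (b : ℝ) (C : ℝ) :
    ∃ ω : ℝ, C * ∫ s in Ioc 0 b, |l s| * Real.exp (-(ω * s)) ≤ 1 / 2 := by
  have hlim : Tendsto (fun n : ℕ => ∫ s in Ioc 0 b, |l s| * Real.exp (-((n : ℝ) * s))) atTop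
      (𝓝 (∫ _ in Ioc 0 b, (0 : ℝ))) := by
    refine tendsto_integral_of_dominated_convergence (fun s => |l s|) (fun n => ?_)
      (h.integrableOn_right b).abs (fun n => ?_) ?_
    · exact (h.integrableOn_right b).abs.aestronglyMeasurable.mul
        (Continuous.aestronglyMeasurable (by fun_prop))
    · filter_upwards [ae_restrict_mem measurableSet_Ioc] with s hs
      rw [norm_mul, Real.norm_eq_abs, abs_abs, Real.norm_eq_abs, Real.abs_exp]
      refine mul_le_of_le_one_right (abs_nonneg _) (Real.exp_le_one_iff.2 ?_)
      have := mul_nonneg (Nat.cast_nonneg (α := ℝ) n) hs.1.le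
      linarith
    · filter_upwards [ae_restrict_mem measurableSet_Ioc] with s hs
      have h1 : Tendsto (fun n : ℕ => Real.exp (-((n : ℝ) * s))) atTop (𝓝 0) :=
        Real.tendsto_exp_neg_atTop_nhds_zero.comp
          (tendsto_natCast_atTop_atTop.atTop_mul_const hs.1)
      simpa using h1.const_mul |l s|
  simp only [integral_zero] at hlim
  have h2 := hlim.const_mul C
  rw [mul_zero] at h2
  obtain ⟨n, hn⟩ := (h2.eventually_le_const (show (0 : ℝ) < 1 / 2 by norm_num)).exists
  exact ⟨n, hn⟩

/-- Uniqueness for the Volterra equation `u = u₀ + l ∗ g(u)`. -/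
lemma eqOn_of_eq_add_conv (h : IsPC k l) {g u v : ℝ → ℝ} {S : Set ℝ} {C : NNReal} {b u₀ : ℝ}
    (hg : LipschitzOnWith C g S) (hu : ContinuousOn u (Icc 0 b)) (hv : ContinuousOn v (Icc 0 b))
    (huS : MapsTo u (Icc 0 b) S) (hvS : MapsTo v (Icc 0 b) S)
    (eu : ∀ t ∈ Icc 0 b, u t = u₀ + conv l (fun s => g (u s)) t)
    (ev : ∀ t ∈ Icc 0 b, v t = u₀ + conv l (fun s => g (v s)) t) : EqOn u v (Icc 0 b) := by
  rcases lt_or_ge b 0 with hb | hb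
  · simp [Icc_eq_empty (not_le.2 hb)]
  obtain ⟨ω, hω⟩ := h.exists_exp_weight b C
  have hgu : ContinuousOn (fun s => g (u s)) (Icc 0 b) := hg.continuousOn.comp hu huS
  have hgv : ContinuousOn (fun s => g (v s)) (Icc 0 b) := hg.continuousOn.comp hv hvS
  have hint : ∀ {w : ℝ → ℝ}, ContinuousOn w (Icc 0 b) → ∀ {t}, t ∈ Icc 0 b →
      IntegrableOn (fun s => l s * w (t - s)) (Ioc 0 t) := fun {w} hw {t} ht => by
    obtain ⟨D, hD⟩ := isCompact_Icc.exists_bound_of_continuousOn hw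
    exact integrableOn_conv_integrand (h.integrableOn_right b)
      ((hw.mono Ioc_subset_Icc_self).aestronglyMeasurable measurableSet_Ioc)
      (fun x hx => hD x (Ioc_subset_Icc_self hx)) ht
  have hcont : ContinuousOn (fun t => Real.exp (-(ω * t)) * |u t - v t|) (Icc 0 b) :=
    (by fun_prop : Continuous fun t => Real.exp (-(ω * t))).continuousOn.mul (hu.sub hv).abs
  obtain ⟨t₁, ht₁, hmax⟩ := isCompact_Icc.exists_isMaxOn ⟨0, le_rfl, hb⟩ hcont
  set M := Real.exp (-(ω * t₁)) * |u t₁ - v t₁| with hM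
  have hw : ∀ r ∈ Icc 0 b, |u r - v r| ≤ M * Real.exp (ω * r) := fun r hr => by
    have h1 : Real.exp (-(ω * r)) * |u r - v r| ≤ M := hmax hr
    rw [Real.exp_neg, inv_mul_le_iff₀ (Real.exp_pos _)] at h1
    linarith
  have hM0 : 0 ≤ M := by positivity
  have hi : IntegrableOn (fun s => |l s| * Real.exp (-(ω * s))) (Ioc 0 b) := by
    have := ((integrableOn_Icc_iff_integrableOn_Ioc (f := fun s => |l s|)).2
      (h.integrableOn_right b).abs).mul_continuousOn
      (g' := fun s => Real.exp (-(ω * s))) (by fun_prop) isCompact_Icc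
    exact this.mono_set Ioc_subset_Icc_self
  have hle : |u t₁ - v t₁| ≤ ∫ s in Ioc 0 t₁,
      (|l s| * Real.exp (-(ω * s))) * (C * (M * Real.exp (ω * t₁))) := by
    rw [eu t₁ ht₁, ev t₁ ht₁, add_sub_add_left_eq_sub, conv_eq_setIntegral _ _ ht₁.1,
      conv_eq_setIntegral _ _ ht₁.1, ← integral_sub (hint hgu ht₁) (hint hgv ht₁),
      ← Real.norm_eq_abs]
    refine norm_integral_le_of_norm_le
      ((hi.mono_set (Ioc_subset_Ioc_right ht₁.2)).mul_const _) ?_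
    filter_upwards [ae_restrict_mem measurableSet_Ioc] with s hs
    have hm : t₁ - s ∈ Icc 0 b := ⟨by linarith [hs.2], by linarith [hs.1, ht₁.2]⟩
    have h1 := hg.dist_le_mul _ (huS hm) _ (hvS hm)
    rw [Real.dist_eq, Real.dist_eq] at h1
    have h2 := hw _ hm
    rw [← mul_sub, norm_mul, Real.norm_eq_abs, Real.norm_eq_abs, mul_assoc]
    refine mul_le_mul_of_nonneg_left ?_ (abs_nonneg _)
    calc _ ≤ (C : ℝ) * (M * Real.exp (ω * (t₁ - s))) :=
          h1.trans (mul_le_mul_of_nonneg_left h2 C.2)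
      _ = _ := by
          rw [show ω * (t₁ - s) = -(ω * s) + ω * t₁ by ring, Real.exp_add]
          ring
  rw [integral_mul_const] at hle
  have hle2 : (∫ s in Ioc 0 t₁, |l s| * Real.exp (-(ω * s)))
      ≤ ∫ s in Ioc 0 b, |l s| * Real.exp (-(ω * s)) :=
    setIntegral_mono_set hi (Eventually.of_forall fun s => by positivity)
      (Ioc_subset_Ioc_right ht₁.2).eventuallyLE
  -- `M` is the weighted sup norm of `u - v`, attained at `t₁`; the contraction estimate at `t₁`
  -- forces `M = 0`.
  have hfin : M ≤ 1 / 2 * M := by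
    have e1 : Real.exp (-(ω * t₁)) * Real.exp (ω * t₁) = 1 := by
      rw [← Real.exp_add]; simp
    calc M ≤ Real.exp (-(ω * t₁)) * ((∫ s in Ioc 0 t₁, |l s| * Real.exp (-(ω * s)))
          * (C * (M * Real.exp (ω * t₁)))) := mul_le_mul_of_nonneg_left hle (Real.exp_pos _).le
      _ = (Real.exp (-(ω * t₁)) * Real.exp (ω * t₁))
          * ((C * ∫ s in Ioc 0 t₁, |l s| * Real.exp (-(ω * s))) * M) := by ring
      _ = (C * ∫ s in Ioc 0 t₁, |l s| * Real.exp (-(ω * s))) * M := by rw [e1, one_mul]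
      _ ≤ _ := mul_le_mul_of_nonneg_right
          ((mul_le_mul_of_nonneg_left hle2 C.2).trans hω) hM0
  have hM1 : M = 0 := by linarith
  intro r hr
  have := hw r hr
  rw [hM1, zero_mul] at this
  exact sub_eq_zero.1 (abs_eq_zero.1 (le_antisymm this (abs_nonneg _)))

/-- Using `max t 0` extends the function by the constant `u₀` to negative times, so that continuity
and monotonicity can be stated on all of `ℝ`. -/
lemma continuous_add_conv (h : IsPC k l) {F : ℝ → ℝ} {D : ℝ} (u₀ : ℝ) (hF : Measurable F)
    (hD : ∀ x, |F x| ≤ D) : Continuous fun t => u₀ + conv l F (max t 0) := by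
  have h1 : ContinuousOn (conv l F) (Ici 0) := fun t ht => by
    have h2 := continuousOn_conv (h.integrableOn_right (t + 1)) hF.aestronglyMeasurable
      (fun x _ => hD x) t ⟨ht, by linarith⟩
    refine h2.mono_of_mem_nhdsWithin ?_
    rw [← Ici_inter_Iic]
    exact inter_mem_nhdsWithin _ (Iic_mem_nhds (by linarith))
  exact continuous_const.add (h1.comp_continuous (by fun_prop) fun t => mem_Ici.2 (le_max_right _ _))

lemma monotone_add_conv (h : IsPC k l) {F : ℝ → ℝ} (u₀ : ℝ) (hF : Monotone F)
    (hF0 : ∀ x, 0 ≤ F x) : Monotone fun t => u₀ + conv l F (max t 0) := by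
  intro s t hst
  have hm : max s 0 ≤ max t 0 := max_le_max_right _ hst
  have := h.conv_monotoneOn (A := max t 0) (hF.monotoneOn _) (fun x _ => hF0 x)
    ⟨le_max_right s 0, hm⟩ ⟨le_max_right t 0, le_rfl⟩ hm
  dsimp only
  linarith

/-- Global solvability of the Volterra equation `u = u₀ + l ∗ g(u)` for a bounded continuous
nondecreasing `g ≥ 0`, by monotone iteration. -/
lemma exists_eq_add_conv (h : IsPC k l) {g : ℝ → ℝ} {D : ℝ} (hg : Monotone g) (hgc : Continuous g)
    (hg0 : ∀ x, 0 ≤ g x) (hgD : ∀ x, g x ≤ D) (u₀ : ℝ) :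
    ∃ u : ℝ → ℝ, Monotone u ∧ Continuous u ∧
      ∀ t, u t = u₀ + conv l (fun s => g (u s)) (max t 0) := by
  have habs : ∀ x, |g x| ≤ D := fun x => by rw [abs_of_nonneg (hg0 x)]; exact hgD x
  set U : ℕ → ℝ → ℝ := fun n => Nat.rec (fun _ => u₀)
    (fun _ v t => u₀ + conv l (fun s => g (v s)) (max t 0)) n with hU
  have hU1 : ∀ n t, U (n + 1) t = u₀ + conv l (fun s => g (U n s)) (max t 0) := fun n t => rfl
  have hmono : ∀ n, Monotone (U n) := by
    intro n
    induction n with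
    | zero => exact monotone_const
    | succ n ih => exact h.monotone_add_conv u₀ (hg.comp ih) fun x => hg0 _
  have hmeas : ∀ n, Measurable fun s => g (U n s) := fun n => (hg.comp (hmono n)).measurable
  have hconv : ∀ (F G : ℝ → ℝ), Measurable F → Measurable G → (∀ x, |F x| ≤ D) →
      (∀ x, |G x| ≤ D) → (∀ x, F x ≤ G x) → (∀ x, 0 ≤ G x) → ∀ t, 0 ≤ t →
      conv l F t ≤ conv l G t := fun F G hF hG hFD hGD hFG hG0 t ht =>
    h.conv_le_conv (A := t) hF.aestronglyMeasurable (fun x _ => hFD x) hG.aestronglyMeasurable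
      (fun x _ => hGD x) ht le_rfl le_rfl (fun x _ => hFG _) fun x _ => hG0 x
  -- The first step uses `g ≥ 0`; afterwards `g` nondecreasing and `l ≥ 0` propagate the order.
  have hstep : ∀ n t, U n t ≤ U (n + 1) t := by
    intro n
    induction n with
    | zero =>
      intro t
      rw [hU1]
      have := hconv (fun _ => 0) (fun s => g (U 0 s)) measurable_const (hmeas 0)
        (fun x => by simpa using (abs_nonneg _).trans (habs x)) (fun x => habs _)
        (fun x => hg0 _) (fun x => hg0 _) (max t 0) (le_max_right _ _)
      have e : conv l (fun _ => 0) (max t 0) = 0 := by simp [conv]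
      rw [e] at this
      change u₀ ≤ _
      linarith
    | succ n ih =>
      intro t
      rw [hU1 n, hU1 (n + 1)]
      have := hconv (fun s => g (U n s)) (fun s => g (U (n + 1) s)) (hmeas n) (hmeas (n + 1))
        (fun x => habs _) (fun x => habs _) (fun x => hg (ih x)) (fun x => hg0 _) (max t 0)
        (le_max_right _ _)
      linarith
  have hmn : ∀ t, Monotone fun n => U n t := fun t => monotone_nat_of_le_succ fun n => hstep n t
  have hbdd : ∀ t, BddAbove (range fun n => U n t) := by
    intro t
    refine ⟨u₀ + (∫ s in (0 : ℝ)..max t 0, |l s|) * D, ?_⟩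
    rintro _ ⟨n, rfl⟩
    refine (hstep n t).trans ?_
    rw [hU1]
    have := abs_conv_le (h.integrableOn_right (max t 0)) (c := fun s => g (U n s))
      (fun x _ => habs _) ⟨le_max_right t 0, le_rfl⟩
    linarith [le_abs_self (conv l (fun s => g (U n s)) (max t 0))]
  set u : ℝ → ℝ := fun t => ⨆ n, U n t with hu
  have hlim : ∀ t, Tendsto (fun n => U n t) atTop (𝓝 (u t)) := fun t =>
    tendsto_atTop_ciSup (hmn t) (hbdd t)
  have hum : Monotone u := fun s t hst =>
    le_of_tendsto_of_tendsto' (hlim s) (hlim t) fun n => hmono n hst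
  have heq : ∀ t, u t = u₀ + conv l (fun s => g (u s)) (max t 0) := by
    intro t
    refine tendsto_nhds_unique ((tendsto_add_atTop_iff_nat 1).2 (hlim t)) ?_
    simp only [hU1]
    refine Tendsto.const_add _ ?_
    simp only [conv_eq_setIntegral _ _ (le_max_right t 0)]
    refine tendsto_integral_of_dominated_convergence (fun s => |l s| * D) (fun n => ?_)
      ((h.integrableOn_right _).abs.mul_const _) (fun n => Eventually.of_forall fun s => ?_)
      (Eventually.of_forall fun s => ?_)
    · exact (h.integrableOn_right _).aestronglyMeasurable.mul
        ((hmeas n).comp (by fun_prop)).aestronglyMeasurable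
    · rw [norm_mul]
      exact mul_le_mul_of_nonneg_left (habs _) (norm_nonneg _)
    · exact ((hgc.tendsto _).comp (hlim _)).const_mul _
  refine ⟨u, hum, ?_, heq⟩
  have := h.continuous_add_conv u₀ (F := fun s => g (u s)) (hg.comp hum).measurable
    (fun x => habs _)
  exact this.congr fun t => (heq t).symm

end IsPC

/-! ### Equivalence of the problem with the Volterra equation -/

lemma AbsolutelyContinuousOnInterval.congr {f g : ℝ → ℝ} {a b : ℝ}
    (hf : AbsolutelyContinuousOnInterval f a b) (hfg : EqOn f g (uIcc a b)) :
    AbsolutelyContinuousOnInterval g a b := by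
  have h0 : LipschitzOnWith 0 (g - f) (uIcc a b) := fun x hx y hy => by
    simp [hfg hx, hfg hy]
  simpa using hf.add h0.absolutelyContinuousOnInterval

lemma AbsolutelyContinuousOnInterval.lipschitz_comp {G y : ℝ → ℝ} {K : NNReal} {a b : ℝ}
    (hG : LipschitzWith K G) (hy : AbsolutelyContinuousOnInterval y a b) :
    AbsolutelyContinuousOnInterval (fun t => G (y t)) a b := by
  unfold AbsolutelyContinuousOnInterval at hy
  refine squeeze_zero (fun E => Finset.sum_nonneg fun i _ => dist_nonneg) (fun E => ?_)
    (by simpa using hy.const_mul (K : ℝ))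
  rw [Finset.mul_sum]
  exact Finset.sum_le_sum fun i _ => hG.dist_le_mul _ _

lemma ae_eq_of_forall_integral_eq {F G : ℝ → ℝ} {a : ℝ} (ha : 0 ≤ a)
    (hF : IntegrableOn F (Ioc 0 a)) (hG : IntegrableOn G (Ioc 0 a))
    (hFG : ∀ t ∈ Icc 0 a, ∫ s in (0 : ℝ)..t, F s = ∫ s in (0 : ℝ)..t, G s) :
    F =ᵐ[volume.restrict (Ioo 0 a)] G := by
  refine (ae_restrict_iff' measurableSet_Ioo).2 ?_
  have iF := (intervalIntegrable_iff_integrableOn_Ioc_of_le ha).2 hF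
  have iG := (intervalIntegrable_iff_integrableOn_Ioc_of_le ha).2 hG
  filter_upwards [iF.ae_hasDerivAt_integral, iG.ae_hasDerivAt_integral] with t h1 h2 ht
  have htu : t ∈ uIcc 0 a := by rw [uIcc_of_le ha]; exact Ioo_subset_Icc_self ht
  have d1 := h1 htu 0 left_mem_uIcc
  have d2 := h2 htu 0 left_mem_uIcc
  refine d1.unique (d2.congr_of_eventuallyEq ?_)
  filter_upwards [Icc_mem_nhds ht.1 ht.2] with s hs using hFG s hs

/-- A continuous solution of the Volterra equation `u = u₀ + l ∗ f(u)` solves the problem. -/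
lemma IsPC.isSolutionOn_of_eq_add_conv {k l : ℝ → ℝ} (h : IsPC k l) {f u : ℝ → ℝ}
    {α₀ m u₀ a : ℝ} (hf : LocallyLipschitzOn (Ioi α₀) f) (hm : α₀ < m) (ha : 0 < a)
    (hu : ContinuousOn u (Icc 0 a)) (hum : ∀ t ∈ Icc 0 a, m ≤ u t)
    (eu : ∀ t ∈ Icc 0 a, u t = u₀ + conv l (fun s => f (u s)) t) :
    IsSolutionOn k f α₀ u₀ a u := by
  have hfu : ContinuousOn (fun s => f (u s)) (Icc 0 a) :=
    hf.continuousOn.comp hu fun t ht => hm.trans_le (hum t ht)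
  obtain ⟨D, hD⟩ := isCompact_Icc.exists_bound_of_continuousOn hfu
  obtain ⟨C, hC⟩ := isCompact_Icc.exists_bound_of_continuousOn hu
  have hconv : ∀ t ∈ Icc 0 a, conv k (fun s => u s - u₀) t = ∫ s in (0 : ℝ)..t, f (u s) := by
    intro t ht
    rw [← h.conv_left_conv_right
      ((hfu.mono Ioc_subset_Icc_self).aestronglyMeasurable measurableSet_Ioc)
      (fun x hx => hD x (Ioc_subset_Icc_self hx)) ht]
    refine conv_congr_ae_right (A := a) ?_ ht
    filter_upwards [ae_restrict_mem measurableSet_Ioc] with s hs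
    rw [eu s (Ioc_subset_Icc_self hs)]
    ring
  have hfi : IntervalIntegrable (fun s => f (u s)) volume 0 a :=
    (hfu.mono (by rw [uIcc_of_le ha.le])).intervalIntegrable
  refine ⟨?_, ⟨m, hm, ?_⟩, ?_, ?_⟩
  · refine memLp_top_of_bound
      ((hu.mono Ioo_subset_Icc_self).aestronglyMeasurable measurableSet_Ioo) C ?_
    filter_upwards [ae_restrict_mem measurableSet_Ioo] with s hs
    exact hC s (Ioo_subset_Icc_self hs)
  · filter_upwards [ae_restrict_mem measurableSet_Ioo] with s hs
    exact hum s (Ioo_subset_Icc_self hs)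
  · refine AbsolutelyContinuousOnInterval.congr
      (hfi.absolutelyContinuousOnInterval_intervalIntegral left_mem_uIcc) fun t ht => ?_
    rw [uIcc_of_le ha.le] at ht
    exact (hconv t ht).symm
  · filter_upwards [ae_restrict_mem measurableSet_Ioo] with t ht
    have hd : HasDerivAt (fun x => ∫ s in (0 : ℝ)..x, f (u s)) (f (u t)) t := by
      refine intervalIntegral.integral_hasDerivAt_right
        (hfu.mono (uIcc_subset_Icc ⟨le_rfl, ha.le⟩ (Ioo_subset_Icc_self ht))).intervalIntegrable ?_
        (hfu.continuousAt (Icc_mem_nhds ht.1 ht.2))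
      exact (hfu.mono Ioo_subset_Icc_self).stronglyMeasurableAtFilter isOpen_Ioo t ht
    refine hd.congr_of_eventuallyEq ?_
    filter_upwards [Icc_mem_nhds ht.1 ht.2] with s hs using hconv s hs

/-- Every solution agrees almost everywhere with a continuous solution of the Volterra equation
`u = u₀ + l ∗ f(u)`. -/
lemma IsPC.exists_eq_add_conv_of_isSolutionOn {k l : ℝ → ℝ} (h : IsPC k l) {f v : ℝ → ℝ}
    {α₀ u₀ a : ℝ} (hf : LocallyLipschitzOn (Ioi α₀) f) (ha : 0 < a)
    (hv : IsSolutionOn k f α₀ u₀ a v) :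
    ∃ w : ℝ → ℝ, ∃ m M : ℝ, α₀ < m ∧ ContinuousOn w (Icc 0 a) ∧ (∀ t ∈ Icc 0 a, w t ∈ Icc m M) ∧
      (∀ t ∈ Icc 0 a, w t = u₀ + conv l (fun s => f (w s)) t) ∧
      v =ᵐ[volume.restrict (Ioo 0 a)] w := by
  obtain ⟨m, hm, hvm⟩ := hv.lower
  set M := max m (eLpNorm v ⊤ (volume.restrict (Ioo 0 a))).toReal with hM
  have hmM : m ≤ M := le_max_left _ _
  have hvM : ∀ᵐ t ∂(volume.restrict (Ioo 0 a)), v t ≤ M := by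
    filter_upwards [ae_le_eLpNormEssSup (f := v) (μ := volume.restrict (Ioo 0 a))] with t ht
    rw [← eLpNorm_exponent_top] at ht
    have h1 := ENNReal.toReal_mono hv.memLp.2.ne ht
    rw [toReal_enorm] at h1
    exact (le_abs_self _).trans (h1.trans (le_max_right _ _))
  -- Clamping to `[m,M]` changes `v` only on a null set, and makes `f ∘ cl` continuous and bounded
  -- on the whole line.
  set cl : ℝ → ℝ := fun x => max m (min x M) with hcl
  have hclc : Continuous cl := by fun_prop
  have hclm : ∀ x, cl x ∈ Icc m M := fun x => ⟨le_max_left _ _, max_le hmM (min_le_right _ _)⟩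
  have hcle : ∀ x ∈ Icc m M, cl x = x := fun x hx => by
    simp only [hcl]; rw [min_eq_left hx.2, max_eq_right hx.1]
  have hfcl : Continuous fun x => f (cl x) :=
    hf.continuousOn.comp_continuous hclc fun x => hm.trans_le (hclm x).1
  obtain ⟨D, hD⟩ := (isCompact_Icc (a := m) (b := M)).exists_bound_of_continuousOn
    (hf.continuousOn.mono fun x hx => hm.trans_le hx.1)
  set v' : ℝ → ℝ := fun t => cl (v t) with hv'
  have hvv' : v =ᵐ[volume.restrict (Ioo 0 a)] v' := by
    filter_upwards [hvm, hvM] with t h1 h2 using (hcle _ ⟨h1, h2⟩).symm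
  have hvv'c : v =ᵐ[volume.restrict (Ioc 0 a)] v' := by
    rwa [← restrict_Ioo_eq_restrict_Ioc]
  have hvmeas : AEStronglyMeasurable v (volume.restrict (Ioc 0 a)) := by
    rw [← restrict_Ioo_eq_restrict_Ioc]; exact hv.memLp.1
  have hv'meas : AEStronglyMeasurable v' (volume.restrict (Ioc 0 a)) :=
    hclc.comp_aestronglyMeasurable hvmeas
  set F : ℝ → ℝ := fun t => f (v' t) with hF
  have hFmeas : AEStronglyMeasurable F (volume.restrict (Ioc 0 a)) :=
    hfcl.comp_aestronglyMeasurable hvmeas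
  have hFD : ∀ x, |F x| ≤ D := fun x => hD _ (hclm _)
  have hFi : IntegrableOn F (Ioc 0 a) :=
    Integrable.of_bound hFmeas D (Eventually.of_forall fun x => hFD x)
  set p := conv k fun τ => v τ - u₀ with hp
  set z : ℝ → ℝ := fun t => v' t - u₀ with hz
  have hpz : ∀ t ∈ Icc 0 a, p t = conv k z t := fun t ht =>
    conv_congr_ae_right (A := a) (by filter_upwards [hvv'c] with s hs; rw [hz, hs]) ht
  have hpF : ∀ t ∈ Icc 0 a, p t = ∫ s in (0 : ℝ)..t, F s := by
    intro t ht
    have hac : AbsolutelyContinuousOnInterval p 0 t := hv.absCont.mono (by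
      rw [uIcc_of_le ht.1, uIcc_of_le ha.le]; exact Icc_subset_Icc_right ht.2)
    have h1 := hac.integral_deriv_eq_sub
    rw [show p 0 = 0 from conv_apply_zero _ _, sub_zero] at h1
    rw [← h1, intervalIntegral.integral_of_le ht.1, intervalIntegral.integral_of_le ht.1,
      integral_Ioc_eq_integral_Ioo, integral_Ioc_eq_integral_Ioo]
    refine setIntegral_congr_ae measurableSet_Ioo ?_
    filter_upwards [(ae_restrict_iff' measurableSet_Ioo).1 hv.equation,
      (ae_restrict_iff' measurableSet_Ioo).1 hvv'] with s h1 h2 hs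
    have hs' : s ∈ Ioo 0 a := ⟨hs.1, hs.2.trans_le ht.2⟩
    rw [(h1 hs').deriv, hF, h2 hs']
  have hzmeas : AEStronglyMeasurable z (volume.restrict (Ioc 0 a)) :=
    hv'meas.sub aestronglyMeasurable_const
  obtain ⟨E, hE⟩ := (isCompact_Icc (a := m) (b := M)).exists_bound_of_continuousOn
    (f := fun x => x - u₀) (by fun_prop)
  have hzE : ∀ x, |z x| ≤ E := fun x => hE _ (hclm _)
  have hlF := continuousOn_conv (h.integrableOn_right a) hFmeas fun x _ => hFD x
  -- `1 ∗ z = l ∗ (k ∗ z) = l ∗ (1 ∗ F) = 1 ∗ (l ∗ F)`, so `z = l ∗ F` almost everywhere.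
  have hzint : ∀ t ∈ Icc 0 a, ∫ s in (0 : ℝ)..t, z s = ∫ s in (0 : ℝ)..t, conv l F s := by
    intro t ht
    have i1 : IntegrableOn (fun _ : ℝ => (1 : ℝ)) (Ioc 0 a) := by simp
    rw [← h.conv_right_conv_left hzmeas (fun x _ => hzE x) ht,
      ← conv_one_left (conv l F), ← conv_assoc i1 (h.integrableOn_right a) hFmeas
        (fun x _ => hFD x) ht, funext (conv_comm (fun _ => 1) l),
      conv_assoc (h.integrableOn_right a) i1 hFmeas (fun x _ => hFD x) ht]
    refine conv_congr_ae_right (A := a) ?_ ht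
    filter_upwards [ae_restrict_mem measurableSet_Ioc] with s hs
    rw [conv_one_left, ← hpF s (Ioc_subset_Icc_self hs), hpz s (Ioc_subset_Icc_self hs)]
  have hzeq : z =ᵐ[volume.restrict (Ioo 0 a)] conv l F :=
    ae_eq_of_forall_integral_eq ha.le (Integrable.of_bound hzmeas E (Eventually.of_forall hzE))
      ((hlF.integrableOn_Icc).mono_set Ioc_subset_Icc_self) hzint
  set w : ℝ → ℝ := fun t => u₀ + conv l F t with hw
  have hwc : ContinuousOn w (Icc 0 a) := continuousOn_const.add hlF
  have hv'w : v' =ᵐ[volume.restrict (Ioo 0 a)] w := by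
    filter_upwards [hzeq] with t ht
    simp only [hw, ← ht, hz]
    ring
  -- The continuous functions `w` and `cl ∘ w` agree almost everywhere, hence everywhere; so `w`
  -- itself takes values in `[m,M]`.
  have hwcl : EqOn w (fun t => cl (w t)) (Icc 0 a) := by
    refine Measure.eqOn_Icc_of_ae_eq volume ha.ne ?_ hwc (hclc.comp_continuousOn hwc)
    rw [← restrict_Ioo_eq_restrict_Icc]
    filter_upwards [hv'w] with t ht
    rw [← ht, hcle _ (hclm _)]
  refine ⟨w, m, M, hm, hwc, fun t ht => hwcl ht ▸ hclm _, fun t ht => ?_, hvv'.trans hv'w⟩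
  simp only [hw]
  congr 1
  refine conv_congr_ae_right (A := a) ?_ ht
  rw [← restrict_Ioo_eq_restrict_Ioc]
  filter_upwards [hv'w] with s hs
  simp only [hF, hs, hw]

/-! ### Growth estimate and blow-up criterion -/

namespace IsPC

variable {k l : ℝ → ℝ}

/-- The growth estimate for the Volterra equation `u = u₀ + l ∗ g(u)`. -/
lemma integral_right_le_integral_one_div (h : IsPC k l) {g u : ℝ → ℝ} {c u₀ t : ℝ}
    (hg : Monotone g) (hgc : Continuous g) (hc : 0 < c) (hcg : ∀ x, c ≤ g x) (hu : Monotone u)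
    (eu : ∀ t, 0 ≤ t → u t = u₀ + conv l (fun s => g (u s)) t) (ht : 0 ≤ t) :
    ∫ s in (0 : ℝ)..t, l s ≤ ∫ x in u₀..u t, 1 / g x := by
  have hgpos : ∀ x, 0 < g x := fun x => hc.trans_le (hcg x)
  have hinv : Continuous fun x => 1 / g x := continuous_const.div hgc fun x => (hgpos x).ne'
  set G : ℝ → ℝ := fun x => ∫ r in u₀..x, 1 / g r with hG
  have hii : ∀ a b, IntervalIntegrable (fun x => 1 / g x) volume a b := fun a b =>
    hinv.intervalIntegrable a b
  have hGd : ∀ x, HasDerivAt G (1 / g x) x := fun x =>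
    intervalIntegral.integral_hasDerivAt_right (hii _ _)
      hinv.stronglyMeasurable.stronglyMeasurableAtFilter hinv.continuousAt
  -- The lower bound `c` on `g` makes `G` Lipschitz. Thus `G ∘ y` is absolutely continuous, although
  -- `y` need not be differentiable everywhere.
  have hGlip : LipschitzWith (Real.toNNReal (1 / c)) G := by
    refine LipschitzWith.of_dist_le_mul fun x y => ?_
    rw [Real.dist_eq, Real.dist_eq, Real.coe_toNNReal _ (by positivity)]
    simp only [hG]
    rw [intervalIntegral.integral_interval_sub_left (hii _ _) (hii _ _), ← Real.norm_eq_abs]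
    refine intervalIntegral.norm_integral_le_of_norm_le_const fun r _ => ?_
    rw [Real.norm_of_nonneg (one_div_pos.2 (hgpos r)).le]
    exact one_div_le_one_div_of_le hc (hcg r)
  have hFm : Monotone fun s => g (u s) := hg.comp hu
  set y : ℝ → ℝ := fun s => u₀ + ∫ x in (0 : ℝ)..s, l x * g (u x) with hy
  have hyu : ∀ s, 0 ≤ s → y s ≤ u s := fun s hs => by
    rw [eu s hs]
    have := h.integral_mul_le_conv hFm (fun x => (hgpos _).le) hs
    simp only [hy]
    linarith
  have il : IntervalIntegrable l volume 0 t := h.intervalIntegrable_right le_rfl ht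
  have ilF : IntervalIntegrable (fun x => l x * g (u x)) volume 0 t := by
    rw [intervalIntegrable_iff_integrableOn_Ioc_of_le ht] at il ⊢
    refine Integrable.mul_bdd (c := g (u t)) il hFm.measurable.aestronglyMeasurable ?_
    filter_upwards [ae_restrict_mem measurableSet_Ioc] with s hs
    rw [Real.norm_of_nonneg (hgpos _).le]
    exact hFm hs.2
  have hyac : AbsolutelyContinuousOnInterval y 0 t := by
    have h0 : LipschitzWith 0 fun _ : ℝ => u₀ := LipschitzWith.const _
    exact h0.lipschitzOnWith.absolutelyContinuousOnInterval.fun_add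
      (ilF.absolutelyContinuousOnInterval_intervalIntegral left_mem_uIcc)
  have hac := (AbsolutelyContinuousOnInterval.lipschitz_comp hGlip hyac).fun_sub
    (il.absolutelyContinuousOnInterval_intervalIntegral left_mem_uIcc)
  have hfin := hac.integral_deriv_eq_sub
  have hy0 : y 0 = u₀ := by simp [hy]
  have hG0 : G u₀ = 0 := by simp [hG]
  rw [hy0, hG0, intervalIntegral.integral_same, sub_zero, sub_zero] at hfin
  -- Almost everywhere `(G ∘ y)' = l g(u) / g(y) ≥ l`, because `y ≤ u` and `g` is nondecreasing.
  have hnn : 0 ≤ ∫ s in (0 : ℝ)..t, deriv (fun x => G (y x) - ∫ r in (0 : ℝ)..x, l r) s := by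
    rw [intervalIntegral.integral_of_le ht]
    refine integral_nonneg_of_ae ((ae_restrict_iff' measurableSet_Ioc).2 ?_)
    filter_upwards [il.ae_hasDerivAt_integral, ilF.ae_hasDerivAt_integral, h.right_nonneg]
      with s h1 h2 h3 hs
    have hsu : s ∈ uIcc 0 t := by rw [uIcc_of_le ht]; exact Ioc_subset_Icc_self hs
    have d1 := h1 hsu 0 left_mem_uIcc
    have d2 : HasDerivAt y (l s * g (u s)) s := (h2 hsu 0 left_mem_uIcc).const_add u₀
    have d3 : HasDerivAt (fun x => G (y x) - ∫ r in (0 : ℝ)..x, l r)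
        (1 / g (y s) * (l s * g (u s)) - l s) s := ((hGd (y s)).comp s d2).sub d1
    rw [d3.deriv]
    have hgy : g (y s) ≤ g (u s) := hg (hyu s hs.1.le)
    have e : 1 / g (y s) * (l s * g (u s)) - l s = l s * (g (u s) - g (y s)) / g (y s) := by
      have := (hgpos (y s)).ne'
      field_simp
    rw [e]
    exact div_nonneg (mul_nonneg (h3 hs.1) (sub_nonneg.2 hgy)) (hgpos _).le
  have hGm : G (y t) ≤ G (u t) := by
    have e := intervalIntegral.integral_interval_sub_left (hii u₀ (u t)) (hii u₀ (y t))
    have : 0 ≤ ∫ x in (y t)..(u t), 1 / g x :=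
      intervalIntegral.integral_nonneg (hyu t ht) fun x _ => (one_div_pos.2 (hgpos x)).le
    simp only [hG]
    linarith
  change _ ≤ G (u t)
  linarith

/-- For every level `M > u₀` there is a nondecreasing solution which reaches `M` before the time
`τ₀`, as soon as the primitive of `l` exceeds `∫_{u₀}^∞ 1/f` at `τ₀`. -/
lemma exists_solution_reaching (h : IsPC k l) {f : ℝ → ℝ} {α₀ u₀ τ₀ : ℝ} (hα : α₀ < u₀)
    (hf_lip : LocallyLipschitzOn (Ioi α₀) f) (hf_pos : ∀ r ∈ Ici u₀, 0 < f r)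
    (hf_mono : MonotoneOn f (Ici u₀)) (hf_int : IntegrableOn (fun r => 1 / f r) (Ioi u₀))
    (hτ₀ : 0 ≤ τ₀) (hlt : ∫ r in Ioi u₀, 1 / f r < ∫ s in (0 : ℝ)..τ₀, l s) {M : ℝ}
    (hM : u₀ < M) :
    ∃ (τ : ℝ) (u : ℝ → ℝ), 0 < τ ∧ τ ≤ τ₀ ∧ Monotone u ∧ Continuous u ∧ u 0 = u₀ ∧ u τ = M ∧
      ∀ t ∈ Icc 0 τ, u t = u₀ + conv l (fun s => f (u s)) t := by
  set cl : ℝ → ℝ := fun x => max u₀ (min x M) with hcl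
  have hclc : Continuous cl := by fun_prop
  have hclm : ∀ x, cl x ∈ Icc u₀ M := fun x => ⟨le_max_left _ _, max_le hM.le (min_le_right _ _)⟩
  have hcle : ∀ x ∈ Icc u₀ M, cl x = x := fun x hx => by
    simp only [hcl]; rw [min_eq_left hx.2, max_eq_right hx.1]
  have hclmono : Monotone cl := fun x y hxy => max_le_max_left _ (min_le_min_right _ hxy)
  -- Freezing `f` outside `[u₀,M]` gives a bounded nonlinearity that agrees with `f` until the
  -- solution reaches `M`.
  set g : ℝ → ℝ := fun x => f (cl x) with hg
  have hgm : Monotone g := fun x y hxy => hf_mono (hclm x).1 (hclm y).1 (hclmono hxy)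
  have hgc : Continuous g :=
    hf_lip.continuousOn.comp_continuous hclc fun x => hα.trans_le (hclm x).1
  have hgl : ∀ x, f u₀ ≤ g x := fun x => hf_mono self_mem_Ici (hclm x).1 (hclm x).1
  have hgu : ∀ x, g x ≤ f M := fun x => hf_mono (hclm x).1 hM.le (hclm x).2
  have hf0 : 0 < f u₀ := hf_pos _ self_mem_Ici
  obtain ⟨u, hum, huc, eu⟩ := h.exists_eq_add_conv hgm hgc (fun x => hf0.le.trans (hgl x)) hgu u₀
  have eu' : ∀ t, 0 ≤ t → u t = u₀ + conv l (fun s => g (u s)) t := fun t ht => by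
    have := eu t
    rwa [max_eq_left ht] at this
  have hu0 : u 0 = u₀ := by rw [eu' 0 le_rfl, conv_apply_zero, add_zero]
  -- If `u τ₀ ≤ M`, then `g = f` on `[u₀, u τ₀]`, and the growth estimate contradicts `hlt`.
  have hbig : M < u τ₀ := by
    by_contra! hle
    have hu0τ : u₀ ≤ u τ₀ := hu0 ▸ hum hτ₀
    have h1 := h.integral_right_le_integral_one_div hgm hgc hf0 hgl hum eu' hτ₀
    rw [intervalIntegral.integral_of_le hu0τ] at h1
    have h2 : ∫ x in Ioc u₀ (u τ₀), 1 / g x = ∫ x in Ioc u₀ (u τ₀), 1 / f x :=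
      setIntegral_congr_fun measurableSet_Ioc fun x hx => by
        simp only [hg]
        rw [hcle x ⟨hx.1.le, hx.2.trans hle⟩]
    have h3 : ∫ x in Ioc u₀ (u τ₀), 1 / f x ≤ ∫ x in Ioi u₀, 1 / f x := by
      refine setIntegral_mono_set hf_int ?_ Ioc_subset_Ioi_self.eventuallyLE
      filter_upwards [ae_restrict_mem measurableSet_Ioi] with x hx
      exact (one_div_pos.2 (hf_pos x (mem_Ici_of_Ioi hx))).le
    linarith
  obtain ⟨τ, hτ, huτ⟩ := intermediate_value_Icc hτ₀ huc.continuousOn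
    (show M ∈ Icc (u 0) (u τ₀) from ⟨by linarith, hbig.le⟩)
  have hτ0 : 0 < τ := lt_of_le_of_ne hτ.1 fun he => by
    rw [← he, hu0] at huτ
    exact hM.ne huτ
  refine ⟨τ, u, hτ0, hτ.2, hum, huc, hu0, huτ, fun t ht => ?_⟩
  rw [eu' t ht.1]
  congr 1
  refine conv_congr_ae_right (A := τ) ?_ ht
  filter_upwards [ae_restrict_mem measurableSet_Ioc] with s hs
  simp only [hg]
  rw [hcle (u s) ⟨hu0 ▸ hum hs.1.le, huτ ▸ hum hs.2⟩]

/-- Two continuous solutions of `u = u₀ + l ∗ f(u)` with values in `(α₀,∞)` coincide. -/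
lemma eqOn_of_eq_add_conv_of_locallyLipschitzOn (h : IsPC k l) {f u v : ℝ → ℝ} {α₀ u₀ b : ℝ}
    (hf : LocallyLipschitzOn (Ioi α₀) f) (hu : ContinuousOn u (Icc 0 b))
    (hv : ContinuousOn v (Icc 0 b)) (huα : ∀ t ∈ Icc 0 b, α₀ < u t)
    (hvα : ∀ t ∈ Icc 0 b, α₀ < v t)
    (eu : ∀ t ∈ Icc 0 b, u t = u₀ + conv l (fun s => f (u s)) t)
    (ev : ∀ t ∈ Icc 0 b, v t = u₀ + conv l (fun s => f (v s)) t) : EqOn u v (Icc 0 b) := by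
  have hS : IsCompact (u '' Icc 0 b ∪ v '' Icc 0 b) :=
    (isCompact_Icc.image_of_continuousOn hu).union (isCompact_Icc.image_of_continuousOn hv)
  have hsub : u '' Icc 0 b ∪ v '' Icc 0 b ⊆ Ioi α₀ := by
    rintro _ (⟨t, ht, rfl⟩ | ⟨t, ht, rfl⟩)
    exacts [huα t ht, hvα t ht]
  obtain ⟨C, hC⟩ := (hf.mono hsub).exists_lipschitzOnWith_of_compact hS
  exact h.eqOn_of_eq_add_conv hC hu hv (fun t ht => Or.inl ⟨t, ht, rfl⟩)
    (fun t ht => Or.inr ⟨t, ht, rfl⟩) eu ev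

/-- Blow-up criterion: the solution blows up if the primitive of `l` exceeds `∫_{u₀}^∞ 1/f`. -/
theorem solutionBlowsUp (h : IsPC k l) {f : ℝ → ℝ} {α₀ u₀ τ₀ : ℝ} (hα : α₀ < u₀)
    (hf_lip : LocallyLipschitzOn (Ioi α₀) f) (hf_pos : ∀ r ∈ Ici u₀, 0 < f r)
    (hf_mono : MonotoneOn f (Ici u₀)) (hf_int : IntegrableOn (fun r => 1 / f r) (Ioi u₀))
    (hτ₀ : 0 ≤ τ₀) (hlt : ∫ r in Ioi u₀, 1 / f r < ∫ s in (0 : ℝ)..τ₀, l s) :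
    SolutionBlowsUp k f α₀ u₀ := by
  choose! τ U hτpos hτle hUm hUc hU0 hUτ eU using
    fun M => h.exists_solution_reaching (M := M) hα hf_lip hf_pos hf_mono hf_int hτ₀ hlt
  have hUge : ∀ M, u₀ < M → ∀ t, 0 ≤ t → u₀ ≤ U M t := fun M hM t ht =>
    hU0 M hM ▸ hUm M hM ht
  have hcoh : ∀ M N, u₀ < M → u₀ < N → ∀ t, 0 ≤ t → t ≤ τ M → t ≤ τ N → U M t = U N t := by
    intro M N hM hN t ht htM htN
    refine h.eqOn_of_eq_add_conv_of_locallyLipschitzOn (b := t) hf_lip (hUc M hM).continuousOn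
      (hUc N hN).continuousOn (fun s hs => hα.trans_le (hUge M hM s hs.1))
      (fun s hs => hα.trans_le (hUge N hN s hs.1))
      (fun s hs => eU M hM s ⟨hs.1, hs.2.trans htM⟩)
      (fun s hs => eU N hN s ⟨hs.1, hs.2.trans htN⟩) ⟨ht, le_rfl⟩
  -- If `τ N ≤ τ M`, the two solutions agree at `τ N`, where one equals `N` and the other is at most
  -- `M < N`.
  have hτlt : ∀ M N, u₀ < M → M < N → τ M < τ N := by
    intro M N hM hMN
    by_contra! hle
    have hN := hM.trans hMN
    have h1 := hcoh M N hM hN (τ N) (hτpos N hN).le hle le_rfl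
    have h2 : U M (τ N) ≤ M := (hUm M hM hle).trans_eq (hUτ M hM)
    rw [h1, hUτ N hN] at h2
    linarith
  -- The blow-up time is the supremum of the times at which the levels are reached. It is never
  -- attained, since `τ M < τ (M + 1)`.
  set T := sSup (τ '' Ioi u₀) with hT
  have hbdd : BddAbove (τ '' Ioi u₀) := ⟨τ₀, by rintro _ ⟨M, hM, rfl⟩; exact hτle M hM⟩
  have hτT : ∀ M, u₀ < M → τ M < T := fun M hM =>
    (hτlt M (M + 1) hM (by linarith)).trans_le
      (le_csSup hbdd ⟨M + 1, by simp only [mem_Ioi]; linarith, rfl⟩)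
  have hex : ∀ t, t < T → ∃ M, u₀ < M ∧ t < τ M := by
    intro t ht
    obtain ⟨_, ⟨M, hM, rfl⟩, hlt⟩ := exists_lt_of_lt_csSup
      (show (τ '' Ioi u₀).Nonempty from ⟨_, u₀ + 1, by simp, rfl⟩) ht
    exact ⟨M, hM, hlt⟩
  choose! N hN hNt using hex
  set u : ℝ → ℝ := fun t => U (N t) t with hu
  have huU : ∀ M, u₀ < M → EqOn u (U M) (Icc 0 (τ M)) := fun M hM t ht => by
    have htT := ht.2.trans_lt (hτT M hM)
    exact hcoh _ _ (hN t htT) hM t ht.1 (hNt t htT).le ht.2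
  have hT0 : 0 < T := (hτpos (u₀ + 1) (by linarith)).trans (hτT _ (by linarith))
  have hu0 : u 0 = u₀ := hU0 _ (hN 0 hT0)
  refine ⟨T, u, ⟨by exact_mod_cast hT0, hu0, ?_, ?_, ?_⟩, ?_⟩
  · intro t ht
    obtain ⟨ht0, htT⟩ := ht
    have htT' : t < T := by exact_mod_cast htT
    have h1 : ContinuousWithinAt u (Icc 0 (τ (N t))) t :=
      ((hUc _ (hN t htT')).continuousOn.congr (huU _ (hN t htT'))) t ⟨ht0, (hNt t htT').le⟩
    refine h1.mono_of_mem_nhdsWithin ?_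
    filter_upwards [self_mem_nhdsWithin, mem_nhdsWithin_of_mem_nhds (Iio_mem_nhds (hNt t htT'))]
      with s hs hs' using ⟨hs.1, hs'.le⟩
  · intro a ha haT
    have haT' : a < T := by exact_mod_cast haT
    have hM := hN a haT'
    have hsub : Icc 0 a ⊆ Icc 0 (τ (N a)) := Icc_subset_Icc_right (hNt a haT').le
    have heq := (huU _ hM).mono hsub
    refine h.isSolutionOn_of_eq_add_conv hf_lip hα ha ((hUc _ hM).continuousOn.congr heq)
      (fun t ht => (heq ht).symm ▸ hUge _ hM t ht.1) fun t ht => ?_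
    rw [heq ht, eU _ hM t (hsub ht)]
    congr 1
    refine conv_congr_ae_right (A := a) ?_ ht
    filter_upwards [ae_restrict_mem measurableSet_Ioc] with s hs
    rw [heq (Ioc_subset_Icc_self hs)]
  · intro a v ha hv
    obtain ⟨w, m, B, hm, hwc, hwm, ew, hvw⟩ := h.exists_eq_add_conv_of_isSolutionOn hf_lip ha hv
    -- A level above the bound `B` of `w`: since `w` agrees with `U M` as long as both exist, `w`
    -- cannot live until `τ M`.
    set M := max B u₀ + 1 with hM
    have hMu : u₀ < M := by linarith [le_max_right B u₀]
    have hMB : B < M := by linarith [le_max_left B u₀]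
    have hcomp : ∀ t, t ∈ Icc 0 a → t ≤ τ M → w t = U M t := fun t ht htM =>
      h.eqOn_of_eq_add_conv_of_locallyLipschitzOn (b := t) hf_lip
        (hwc.mono (Icc_subset_Icc_right ht.2)) (hUc M hMu).continuousOn
        (fun s hs => hm.trans_le (hwm s ⟨hs.1, hs.2.trans ht.2⟩).1)
        (fun s hs => hα.trans_le (hUge M hMu s hs.1))
        (fun s hs => ew s ⟨hs.1, hs.2.trans ht.2⟩)
        (fun s hs => eU M hMu s ⟨hs.1, hs.2.trans htM⟩) ⟨ht.1, le_rfl⟩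
    have haM : a < τ M := by
      by_contra! hle
      have hmem : τ M ∈ Icc 0 a := ⟨(hτpos M hMu).le, hle⟩
      have h1 := hcomp _ hmem le_rfl
      have h2 := (hwm _ hmem).2
      rw [h1, hUτ M hMu] at h2
      linarith
    refine ⟨by exact_mod_cast (haM.trans (hτT M hMu)).le, ?_⟩
    filter_upwards [hvw, ae_restrict_mem measurableSet_Ioo] with t h1 h2
    rw [h1, hcomp t (Ioo_subset_Icc_self h2) (h2.2.trans haM).le,
      huU M hMu ⟨h2.1.le, (h2.2.trans haM).le⟩]
  · rw [ENNReal.tendsto_nhds_top_iff_nat]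
    intro n
    set M := max (n : ℝ) u₀ + 1 with hM
    have hMu : u₀ < M := by linarith [le_max_right (n : ℝ) u₀]
    have hMn : (n : ℝ) < M := by linarith [le_max_left (n : ℝ) u₀]
    filter_upwards [Ioo_mem_nhdsLT (hτT M hMu)] with a ha
    by_contra! hle
    -- On `(τ M, a)` the solution is at least `M > n`, so an essential bound by `n` would make this
    -- nonempty interval a null set.
    have hae : ∀ᵐ t ∂(volume.restrict (Ioo (τ M) a)), False := by
      have hsub : Ioo (τ M) a ⊆ Ioo 0 a := Ioo_subset_Ioo_left (hτpos M hMu).le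
      filter_upwards [ae_restrict_of_ae_restrict_of_subset hsub
        (ae_le_eLpNormEssSup (f := u) (μ := volume.restrict (Ioo 0 a))),
        ae_restrict_mem measurableSet_Ioo] with t h1 h2
      rw [← eLpNorm_exponent_top] at h1
      have h3 := ENNReal.toReal_mono (ENNReal.natCast_ne_top n) (h1.trans hle)
      rw [toReal_enorm, ENNReal.toReal_natCast, Real.norm_eq_abs] at h3
      have htT : t < T := h2.2.trans ha.2
      have hNu := hN t htT
      have h0M := (hτpos M hMu).le
      have h4 : U (N t) (τ M) ≤ U (N t) t := hUm _ hNu h2.1.le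
      rw [hcoh (N t) M hNu hMu (τ M) h0M (h2.1.le.trans (hNt t htT).le) le_rfl, hUτ M hMu] at h4
      have h5 := le_abs_self (u t)
      change M ≤ u t at h4
      linarith
    rw [ae_iff] at hae
    simp only [not_false_eq_true, ofPred_true, Measure.restrict_apply_univ, Real.volume_Ioo,
      ENNReal.ofReal_eq_zero] at hae
    linarith [ha.1]

end IsPC

/-! ### Comparing the primitive of `l` with the tail of `∫ 1/f` -/

namespace IsPC

variable {k l : ℝ → ℝ}

/-- A vanishing integral of `l ≥ 0` would give `l = 0` almost everywhere on `(0,t)`, contradicting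
`k ∗ l = 1` there. -/
lemma integral_right_pos (h : IsPC k l) {t : ℝ} (ht : 0 < t) : 0 < ∫ s in (0 : ℝ)..t, l s := by
  refine lt_of_le_of_ne (h.integral_right_nonneg le_rfl ht.le) fun he => ?_
  have hnn : 0 ≤ᵐ[volume.restrict (Ioc 0 t)] l :=
    h.right_nonneg_restrict _ Ioc_subset_Ioi_self
  rw [intervalIntegral.integral_of_le ht.le, eq_comm,
    setIntegral_eq_zero_iff_of_nonneg_ae hnn (h.integrableOn_right t)] at he
  have hae : ∀ᵐ _ ∂(volume.restrict (Ioc 0 t)), False := by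
    filter_upwards [h.conv_ae_eq_one t, ae_restrict_mem measurableSet_Ioc] with s h1 h2
    rw [conv_congr_ae_right he (Ioc_subset_Icc_self h2)] at h1
    simp [conv] at h1
  rw [ae_iff] at hae
  simp only [not_false_eq_true, ofPred_true, Measure.restrict_apply_univ, Real.volume_Ioc,
    ENNReal.ofReal_eq_zero] at hae
  linarith

/-- Since `l ≥ 0`, a bounded primitive would make `l` integrable. -/
lemma exists_lt_integral_right (h : IsPC k l) (hl : ¬ IntegrableOn l (Ioi 0)) (I : ℝ) :
    ∃ t, 0 ≤ t ∧ I < ∫ s in (0 : ℝ)..t, l s := by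
  by_contra! hle
  refine hl (integrableOn_Ioi_of_intervalIntegral_norm_bounded I 0
    (fun n : ℕ => h.integrableOn_right n) tendsto_natCast_atTop_atTop
    (Eventually.of_forall fun n => ?_))
  refine le_trans (le_of_eq ?_) (hle n (Nat.cast_nonneg n))
  refine intervalIntegral.integral_congr_ae ?_
  filter_upwards [h.right_nonneg] with s hs hs'
  rw [uIoc_of_le (Nat.cast_nonneg n)] at hs'
  exact Real.norm_of_nonneg (hs hs'.1)

end IsPC

lemma exists_setIntegral_Ioi_lt {g : ℝ → ℝ} {α ε : ℝ} (hg : IntegrableOn g (Ioi α)) (hε : 0 < ε) :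
    ∃ β, α ≤ β ∧ ∫ r in Ioi β, g r < ε := by
  have h1 := intervalIntegral_tendsto_integral_Ioi α hg tendsto_id
  obtain ⟨β, h2, hβ⟩ := ((h1.eventually (lt_mem_nhds (show (∫ r in Ioi α, g r) - ε
    < ∫ r in Ioi α, g r by linarith))).and (eventually_ge_atTop α)).exists
  refine ⟨β, hβ, ?_⟩
  have e : ∫ r in Ioi α, g r = (∫ r in Ioc α β, g r) + ∫ r in Ioi β, g r := by
    rw [← setIntegral_union (Ioc_disjoint_Ioi le_rfl) measurableSet_Ioi
      (hg.mono_set Ioc_subset_Ioi_self) (hg.mono_set (Ioi_subset_Ioi hβ)),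
      Ioc_union_Ioi_eq_Ioi hβ]
  rw [id, intervalIntegral.integral_of_le hβ] at h2
  linarith

end Subdiffusion

theorem theorem6p1 (k l : ℝ → ℝ) (hkl : Subdiffusion.IsPC k l)
    (α₀ α : ℝ) (hα : α₀ < α) (f : ℝ → ℝ)
    (hf_lip : LocallyLipschitzOn (Set.Ioi α₀) f)
    (hf_pos : ∀ r ∈ Set.Ici α, 0 < f r)
    (hf_mono : MonotoneOn f (Set.Ici α))
    (hf_int : MeasureTheory.IntegrableOn (fun r => 1 / f r) (Set.Ioi α)) :
    (¬ MeasureTheory.IntegrableOn l (Set.Ioi 0) →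
      ∀ u₀ : ℝ, α ≤ u₀ → Subdiffusion.SolutionBlowsUp k f α₀ u₀) ∧
    (MeasureTheory.IntegrableOn l (Set.Ioi 0) →
      ∃ β : ℝ, α ≤ β ∧ ∀ u₀ : ℝ, β ≤ u₀ → Subdiffusion.SolutionBlowsUp k f α₀ u₀) := by
  have key : ∀ u₀ τ₀ : ℝ, α ≤ u₀ → 0 ≤ τ₀ →
      ∫ r in Set.Ioi u₀, 1 / f r < ∫ s in (0 : ℝ)..τ₀, l s →
      Subdiffusion.SolutionBlowsUp k f α₀ u₀ := fun u₀ τ₀ hu hτ hlt =>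
    hkl.solutionBlowsUp (hα.trans_le hu) hf_lip (fun r hr => hf_pos r (hu.trans hr))
      (hf_mono.mono (Ici_subset_Ici.2 hu)) (hf_int.mono_set (Ioi_subset_Ioi hu)) hτ hlt
  refine ⟨fun hl u₀ hu => ?_, fun _ => ?_⟩
  · obtain ⟨τ₀, hτ, hlt⟩ := hkl.exists_lt_integral_right hl (∫ r in Set.Ioi u₀, 1 / f r)
    exact key u₀ τ₀ hu hτ hlt
  -- The time `1` is arbitrary: any positive time has a positive primitive of `l`, and `β` is chosen
  -- so that the tail of `∫ 1/f` lies below it.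
  · obtain ⟨β, hβ, hlt⟩ := Subdiffusion.exists_setIntegral_Ioi_lt hf_int
      (hkl.integral_right_pos one_pos)
    refine ⟨β, hβ, fun u₀ hu => key u₀ 1 (hβ.trans hu) zero_le_one (lt_of_le_of_lt ?_ hlt)⟩
    refine setIntegral_mono_set (hf_int.mono_set (Ioi_subset_Ioi hβ)) ?_
      (Ioi_subset_Ioi hu).eventuallyLE
    filter_upwards [ae_restrict_mem measurableSet_Ioi] with x hx
    exact (one_div_pos.2 (hf_pos x (hβ.trans (le_of_lt hx)))).le
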